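/- **Setting.** Fix $N\ge 1$ agents per game and an action space $[\underline b,\overline b]$, $\underline b<\overline b$, $a=\overline b-\underline b$. Observed actions $B_{i,\ell}\in[\underline b,\overline b]$, $i=1,\dots,N$, $\ell=1,\dots,L$, are i.i.d. across games and agents with law $G$; $S=NL$, and $S\to\infty$ means $L\to\infty$ with $N$ fixed. With allocation function $D(b_i,b_{-i})$ and payment function $C(b_i,b_{-i})$ let $P(b)=E[D(b,B_{-i})]$ and $T(b)=E[C(b,B_{-i})]$, where the $N-1$ components of $B_{-i}$ are i.i.d. with law $G$. Assume these expectations exist, $P,T\in C^2(\underline b,\overline b)$, $P'>0$ on $(\underline b,\overline b)$, and $\xi=T'/P'$ extends continuously to $[\underline b,\overline b]$. Let $h$ be a known function with $0<hP'\le K<\infty$ on $(\underline b,\overline b)$ for some constant $K$. The null hypothesis is $H_0$: $\xi$ is weakly increasing; $H_1$ is its negation. Put $M(b,q)=\int_b^{b+a/q}hT'$, $W(b,q)=\int_b^{b+a/q}hP'$ and $\nu(b_1,b_2,q)=M(b_2,q)W(b_1,q)-M(b_1,q)W(b_2,q)$ on $$\mathcal L=\Big\{(b_1,b_2,q):\ q\in\{2,3,\dots\},\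 b_1>b_2,\ \tfrac{(b_1-\underline b)q}{a},\tfrac{(b_2-\underline b)q}{a}\in\{0,1,\dots,q-1\}\Big\}.$$ Let $\widehat M,\widehat W$ be estimators of $M,W$ that are functions of the sample, and $\widehat\nu(b_1,b_2,q)=\widehat M(b_2,q)\widehat W(b_1,q)-\widehat M(b_1,q)\widehat W(b_2,q)$. Let $\widehat\nu^*$ be the same estimator computed from a bootstrap sample of $L$ games, drawn i.i.d. uniformly from the $L$ observed games, $\Phi^*=\sqrt S(\widehat\nu^*-\widehat\nu)$, and let $P^*$ be probability conditional on the data. Let $\widehat\sigma^2_\nu$ be a variance estimator on $\mathcal L$. **Assumptions.** 1. $\sqrt S(\widehat\nu-\nu)\Rightarrow\Phi_\kappa$ in $\ell^\infty(\mathcal L)$, where $\Phi_\kappa$ is a mean-zero Gaussian process with covariance kernel $\kappa\not\equiv0$. 2. With $\sigma^2_\nu(p)=\kappa(p,p)$, $\sup_{p\in\mathcal L}|\widehat\sigma^2_\nu(p)-\sigma^2_\nu(p)|\to0$ in probability, and $\sigma^2_\nu(p_0)>0$ for $p_0=((\underline b+\overline b)/2,\underline b,2)$. 3. $\Phi^*\Rightarrow\Phi_\kappa$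 in $\ell^\infty(\mathcal L)$ conditionally on the data, in probability (the bounded-Lipschitz distance of the conditional law of $\Phi^*$ to the law of $\Phi_\kappa$ tends to $0$ in outer probability). 4. $(\kappa_S),(\beta_S)$ are positive sequences with $\kappa_S\to\infty$, $\kappa_S/\sqrt S\to0$, $\beta_S$ non-decreasing, $\beta_S\to\infty$, $\beta_S/\kappa_S\to0$. **Test.** Let $\varepsilon>0$, $0<\eta<\alpha<1/2$, and $Q>0$ on $\mathcal L$ with $\sum_{\mathcal L}Q<\infty$. Put $\widehat\sigma_{\nu,\varepsilon}(p)=\sqrt{\max\{\widehat\sigma^2_\nu(p),\varepsilon\,\widehat\sigma^2_\nu(p_0)\}}$, $\psi_S(p)=-\beta_S\,1\{\sqrt S\,\widehat\nu(p)/\widehat\sigma_{\nu,\varepsilon}(p)<-\kappa_S\}$, $$\widehat T_S=\sum_{p\in\mathcal L}\max\Big\{\sqrt S\,\frac{\widehat\nu(p)}{\widehat\sigma_{\nu,\varepsilon}(p)},0\Big\}^2Q(p),$$ $$\widehat c_\eta=\sup\Big\{c\in\mathbb R: P^*\Big(\sum_{p\in\mathcal L}\max\Big\{\frac{\Phi^*(p)}{\widehat\sigma_{\nu,\varepsilon}(p)}+\psi_S(p),0\Big\}^2Q(p)\le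 c\Big)\le1-\alpha+\eta\Big\}+\eta.$$ **Theorem.** (a) Under $H_0$, $\lim_{S\to\infty}P(\widehat T_S>\widehat c_\eta)$ exists and is at most $\alpha$. (b) Under $H_1$, $\lim_{S\to\infty}P(\widehat T_S>\widehat c_\eta)=1$. -/

import Mathlib

open MeasureTheory ProbabilityTheory Filter Topology Set
open scoped ENNReal

noncomputable section

namespace MonotoneTest

/-! ### The game: interim allocation, interim transfer, quasi-inverse strategy -/

/-- The data: actions `B ℓ i` of agent `i` in game `ℓ`, i.i.d. across games and agents, with
common law `G` and values in the action space `[bl, bu]`. -/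
structure IsActionSample {Ω : Type*} [MeasurableSpace Ω] (Pr : Measure Ω) (N : ℕ) (bl bu : ℝ)
    (G : Measure ℝ) (B : ℕ → Fin N → Ω → ℝ) : Prop where
  measurable : ∀ ℓ i, Measurable (B ℓ i)
  indep : iIndepFun (fun p : ℕ × Fin N => B p.1 p.2) Pr
  law : ∀ ℓ i, Pr.map (B ℓ i) = G
  mem_actions : ∀ ℓ i, ∀ᵐ ω ∂Pr, B ℓ i ω ∈ Icc bl bu

/-- Reduced form of an outcome `D (own action) (rivals' actions)`: its expectation given the own
action `b`, when the `N - 1` rivals' actions are i.i.d. with law `G`. With `D` the allocation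
function this is `P(b)`; with the payment function in its place it is `T(b)`. -/
def interim (N : ℕ) (G : Measure ℝ) (D : ℝ → (Fin (N - 1) → ℝ) → ℝ) (b : ℝ) : ℝ :=
  ∫ y, D b y ∂(Measure.pi fun _ : Fin (N - 1) => G)

/-- The quasi-inverse strategy `ξ = T' / P'`. -/
def xi (P T : ℝ → ℝ) (b : ℝ) : ℝ := deriv T b / deriv P b

/-- Regularity of the reduced forms: `P` and `T` are `C²` on `(bl, bu)`, `P' > 0` there, and
`ξ = T' / P'` extends continuously to `[bl, bu]`. -/
structure RegularReducedForm (bl bu : ℝ) (P T : ℝ → ℝ) : Prop where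
  contDiff_P : ContDiffOn ℝ 2 P (Ioo bl bu)
  contDiff_T : ContDiffOn ℝ 2 T (Ioo bl bu)
  deriv_pos : ∀ b ∈ Ioo bl bu, 0 < deriv P b
  left_limit : ∃ x, Tendsto (xi P T) (𝓝[>] bl) (𝓝 x)
  right_limit : ∃ x, Tendsto (xi P T) (𝓝[<] bu) (𝓝 x)

/-- The known weight function `h`: measurable, with `0 < h P' ≤ K < ∞`. -/
structure IsWeight (bl bu : ℝ) (P h : ℝ → ℝ) : Prop where
  measurable : Measurable h
  bound : ∃ K : ℝ, ∀ b ∈ Ioo bl bu, 0 < h b * deriv P b ∧ h b * deriv P b ≤ K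

/-! ### The countable family of moment inequalities -/

/-- The index set `𝓛`: triples `(b₁, b₂, q)`, `q ≥ 2`, with `b₁ > b₂` and
`(b₁ - bl) q / a, (b₂ - bl) q / a ∈ {0, …, q - 1}`, where `a = bu - bl`. -/
def indexSet (bl bu : ℝ) : Set (ℝ × ℝ × ℕ) :=
  {p | 2 ≤ p.2.2 ∧ p.2.1 < p.1 ∧
    (∃ j : ℕ, j < p.2.2 ∧ p.1 = bl + (bu - bl) * j / p.2.2) ∧
    (∃ j : ℕ, j < p.2.2 ∧ p.2.1 = bl + (bu - bl) * j / p.2.2)}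

/-- `𝓛` as a type. -/
abbrev Idx (bl bu : ℝ) : Type := ↥(indexSet bl bu)

/-- The reference index, with `q = 2` and the two points `bl` and `(bl + bu) / 2`. -/
def refIdx {bl bu : ℝ} (hb : bl < bu) : Idx bl bu :=
  ⟨((bl + bu) / 2, bl, 2), le_refl 2, by simp only; linarith,
    ⟨1, by norm_num, by simp only [Nat.cast_one, Nat.cast_ofNat]; ring⟩,
    ⟨0, by norm_num, by simp⟩⟩

/-- `∫_b^{b + a/q} h f'`: this is `M(b, q)` for `f = T` and `W(b, q)` for `f = P`. -/
def cellIntegral (bl bu : ℝ) (h f : ℝ → ℝ) (b : ℝ) (q : ℕ) : ℝ :=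
  ∫ x in b..(b + (bu - bl) / q), h x * deriv f x

/-- `ν(b₁, b₂, q) = M(b₂, q) W(b₁, q) - M(b₁, q) W(b₂, q)`, built from any `M` and `W`. -/
def nuOf {bl bu : ℝ} (M W : ℝ → ℕ → ℝ) (p : Idx bl bu) : ℝ :=
  M p.1.2.1 p.1.2.2 * W p.1.1 p.1.2.2 - M p.1.1 p.1.2.2 * W p.1.2.1 p.1.2.2

/-- The population moments `ν`. -/
def nu (bl bu : ℝ) (P T h : ℝ → ℝ) : Idx bl bu → ℝ :=
  nuOf (cellIntegral bl bu h T) (cellIntegral bl bu h P)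

/-! ### Estimators and the bootstrap of games -/

/-- A sample of `L` games with `N` agents each. -/
abbrev Sample (N L : ℕ) : Type := Fin L → Fin N → ℝ

/-- The estimators of `M` and of `W`: for each number of games, a function of the sample and
of `(b, q)`. -/
abbrev Estimator (N : ℕ) : Type := (L : ℕ) → Sample N L → ℝ → ℕ → ℝ

/-- For fixed `(b, q)` the estimator is a measurable function of the sample. -/
def Estimator.IsMeasurable {N : ℕ} (E : Estimator N) : Prop :=
  ∀ L b q, Measurable fun x : Sample N L => E L x b q

/-- The observed sample of the first `L` games. -/
def sample {Ω : Type*} {N : ℕ} (B : ℕ → Fin N → Ω → ℝ) (L : ℕ) (ω : Ω) : Sample N L :=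
  fun ℓ i => B ℓ i ω

/-- The estimator `ν̂`. -/
def nuHat {bl bu : ℝ} {N L : ℕ} (Mhat What : Estimator N) (x : Sample N L) : Idx bl bu → ℝ :=
  nuOf (Mhat L x) (What L x)

/-- `√S` with `S = N L` the number of observed actions. -/
def sqrtS (N L : ℕ) : ℝ := Real.sqrt ((N * L : ℕ) : ℝ)

/-- The process `√S (ν̂ - ν)`. -/
def estProcess {bl bu : ℝ} {N L : ℕ} (Mhat What : Estimator N) (ν : Idx bl bu → ℝ)
    (x : Sample N L) (p : Idx bl bu) : ℝ :=
  sqrtS N L * (nuHat Mhat What x p - ν p)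

/-- The bootstrap sample of games that consists of the games `ι 1, …, ι L` of the sample. -/
def resample {N L : ℕ} (x : Sample N L) (ι : Fin L → Fin L) : Sample N L := fun ℓ => x (ι ℓ)

/-- The bootstrap process `Φ* = √S (ν̂* - ν̂)`; `ν̂*` is the estimator at the bootstrap sample. -/
def bootProcess {bl bu : ℝ} {N L : ℕ} (Mhat What : Estimator N) (x : Sample N L)
    (ι : Fin L → Fin L) (p : Idx bl bu) : ℝ :=
  sqrtS N L * (nuHat Mhat What (resample x ι) p - nuHat Mhat What x p)

/-- Conditional expectation `E*` given the sample: the indices `ι 1, …, ι L` are i.i.d. uniform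
on `{1, …, L}`, that is, `ι` is uniform on the `L ^ L` self-maps of `{1, …, L}`. -/
def bootExp {L : ℕ} (g : (Fin L → Fin L) → ℝ) : ℝ := (∑ ι, g ι) / (L : ℝ) ^ L

open Classical in
/-- Conditional probability `P*` given the sample. -/
def bootProb {L : ℕ} (A : (Fin L → Fin L) → Prop) : ℝ := bootExp fun ι => if A ι then 1 else 0

/-! ### Weak convergence in `ℓ^∞` -/

/-- The space `ℓ^∞(I)` of bounded functions on `I` with the supremum norm. -/
abbrev Linf (I : Type) : Type := ↥(lp (fun _ : I => ℝ) ∞)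

instance instMeasurableSpaceLinf (I : Type) : MeasurableSpace (Linf I) := borel _

instance instBorelSpaceLinf (I : Type) : BorelSpace (Linf I) := ⟨rfl⟩

/-- A bounded function on `I` as an element of `ℓ^∞(I)` (and `0` for an unbounded one). -/
def toLinf {I : Type} (z : I → ℝ) : Linf I :=
  open Classical in if hz : Memℓp z ∞ then ⟨z, hz⟩ else 0

/-- `Γ` is the law on `ℓ^∞(I)` of a centered Gaussian process with covariance kernel `κ`. -/
structure IsGaussianLaw {I : Type} (Γ : Measure (Linf I)) (κ : I → I → ℝ) : Prop where
  isProbabilityMeasure : IsProbabilityMeasure Γ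
  gaussian : IsGaussianProcess (fun (i : I) (z : Linf I) => z i) Γ
  mean : ∀ i, ∫ z : Linf I, z i ∂Γ = 0
  cov : ∀ i j, covariance (fun z : Linf I => z i) (fun z : Linf I => z j) Γ = κ i j

/-- Outer expectation of a bounded real function that need not be measurable. -/
def outerExp {Ω : Type*} [MeasurableSpace Ω] (Pr : Measure Ω) (g : Ω → ℝ) : ℝ :=
  sInf {r | ∃ u : Ω → ℝ, Measurable u ∧ Integrable u Pr ∧ (∀ ω, g ω ≤ u ω) ∧ r = ∫ ω, u ω ∂Pr}

/-- Weak convergence `Z_L ⇒ Γ` in `ℓ^∞(I)`: the paths are bounded and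
`E^* f(Z_L) → ∫ f dΓ` for every bounded continuous `f` on `ℓ^∞(I)`. -/
structure WeakConv {Ω : Type*} [MeasurableSpace Ω] (Pr : Measure Ω) {I : Type}
    (Z : ℕ → Ω → I → ℝ) (Γ : Measure (Linf I)) : Prop where
  bounded : ∀ L ω, Memℓp (Z L ω) ∞
  tendsto : ∀ f : Linf I → ℝ, Continuous f → (∃ K, ∀ z, |f z| ≤ K) →
    Tendsto (fun L => outerExp Pr fun ω => f (toLinf (Z L ω))) atTop (𝓝 (∫ z, f z ∂Γ))

/-- Functions on `ℓ^∞(I)` that are bounded by `1` and `1`-Lipschitz. -/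
def IsBL1 {I : Type} (f : Linf I → ℝ) : Prop := (∀ z, |f z| ≤ 1) ∧ LipschitzWith 1 f

/-- Weak convergence of the bootstrap process given the sample, in probability: the paths are
bounded and `sup_{f ∈ BL₁} |E* f(Z*_L) - ∫ f dΓ| → 0` in (outer) probability. -/
structure BootWeakConv {Ω : Type*} [MeasurableSpace Ω] (Pr : Measure Ω) {I : Type}
    (Zs : (L : ℕ) → Ω → (Fin L → Fin L) → I → ℝ) (Γ : Measure (Linf I)) : Prop where
  bounded : ∀ L ω ι, Memℓp (Zs L ω ι) ∞
  tendsto : ∀ δ > 0, Tendsto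
    (fun L => Pr {ω | ∃ f : Linf I → ℝ, IsBL1 f ∧
      δ < |bootExp (fun ι => f (toLinf (Zs L ω ι))) - ∫ z, f z ∂Γ|}) atTop (𝓝 0)

/-! ### Variance estimators and tuning parameters -/

/-- Uniform consistency: `sup_{p ∈ I} |σ̂²(p) - σ²(p)| → 0` in probability. -/
def UniformlyConsistent {Ω : Type*} [MeasurableSpace Ω] (Pr : Measure Ω) {I : Type}
    (s2hat : ℕ → Ω → I → ℝ) (s2 : I → ℝ) : Prop :=
  ∀ δ > 0, Tendsto (fun L => Pr {ω | ∃ p, δ < |s2hat L ω p - s2 p|}) atTop (𝓝 0)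

/-- `σ̂_{ν,ε} = √(max {σ̂², ε σ̂²(reference index)})`. -/
def sigmaEps {bl bu : ℝ} (hb : bl < bu) (ε : ℝ) (s2hat : Idx bl bu → ℝ) (p : Idx bl bu) : ℝ :=
  Real.sqrt (max (s2hat p) (ε * s2hat (refIdx hb)))

/-- The conditions on the generalized moment selection sequences `κ_S` and `β_S`. -/
structure GMSRates (kap beta : ℕ → ℝ) : Prop where
  kap_pos : ∀ S, 0 < kap S
  beta_pos : ∀ S, 0 < beta S
  kap_tendsto : Tendsto kap atTop atTop
  kap_rate : Tendsto (fun S : ℕ => kap S / Real.sqrt S) atTop (𝓝 0)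
  beta_mono : Monotone beta
  beta_tendsto : Tendsto beta atTop atTop
  beta_rate : Tendsto (fun S => beta S / kap S) atTop (𝓝 0)

/-! ### The test -/

/-- The Cramér–von Mises functional `∑_p max {z p, 0}² Q p`, with value `∞` if the series
diverges. -/
def cvm {I : Type} (Q z : I → ℝ) : ℝ≥0∞ := ∑' p, ENNReal.ofReal ((max (z p) 0) ^ 2 * Q p)

/-- The studentized moments `√S ν̂ / σ̂_{ν,ε}`; `s` stands for `σ̂_{ν,ε}`. -/
def studentized {bl bu : ℝ} {N L : ℕ} (Mhat What : Estimator N) (s : Idx bl bu → ℝ)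
    (x : Sample N L) (p : Idx bl bu) : ℝ :=
  sqrtS N L * (nuHat Mhat What x p / s p)

/-- The test statistic `T̂_S`. -/
def testStat {bl bu : ℝ} {N L : ℕ} (Mhat What : Estimator N) (Q s : Idx bl bu → ℝ)
    (x : Sample N L) : ℝ≥0∞ :=
  cvm Q (studentized Mhat What s x)

open Classical in
/-- The generalized moment selection function `ψ_S = -β_S 1(√S ν̂ / σ̂_{ν,ε} < -κ_S)`. -/
def gms {bl bu : ℝ} {N L : ℕ} (Mhat What : Estimator N) (kap beta : ℕ → ℝ)
    (s : Idx bl bu → ℝ) (x : Sample N L) (p : Idx bl bu) : ℝ :=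
  -beta (N * L) * (if studentized Mhat What s x p < -kap (N * L) then 1 else 0)

/-- The simulated statistic `∑ max {Φ* / σ̂_{ν,ε} + ψ_S, 0}² Q`. -/
def bootStat {bl bu : ℝ} {N L : ℕ} (Mhat What : Estimator N) (kap beta : ℕ → ℝ)
    (Q s : Idx bl bu → ℝ) (x : Sample N L) (ι : Fin L → Fin L) : ℝ≥0∞ :=
  cvm Q fun p => bootProcess Mhat What x ι p / s p + gms Mhat What kap beta s x p

/-- The critical value `ĉ_η = sup {c : P*(simulated statistic ≤ c) ≤ 1 - α + η} + η`, in the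
extended reals. -/
def critVal {bl bu : ℝ} {N L : ℕ} (Mhat What : Estimator N) (kap beta : ℕ → ℝ)
    (Q s : Idx bl bu → ℝ) (α η : ℝ) (x : Sample N L) : EReal :=
  sSup {c : EReal | ∃ r : ℝ, c = (r : EReal) ∧
    bootProb (fun ι => ((bootStat Mhat What kap beta Q s x ι : ℝ≥0∞) : EReal) ≤ (r : EReal))
      ≤ 1 - α + η} + (η : EReal)

/-- The probability that the test based on `L` games rejects: `P(T̂_S > ĉ_η)`. -/
def rejectProb {Ω : Type*} [MeasurableSpace Ω] (Pr : Measure Ω) {N : ℕ} {bl bu : ℝ}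
    (hb : bl < bu) (B : ℕ → Fin N → Ω → ℝ) (Mhat What : Estimator N)
    (s2hat : ℕ → Ω → Idx bl bu → ℝ) (Q : Idx bl bu → ℝ) (kap beta : ℕ → ℝ) (ε α η : ℝ)
    (L : ℕ) : ℝ :=
  Pr.real {ω | critVal Mhat What kap beta Q (sigmaEps hb ε (s2hat L ω)) α η (sample B L ω)
    < ((testStat Mhat What Q (sigmaEps hb ε (s2hat L ω)) (sample B L ω) : ℝ≥0∞) : EReal)}

end MonotoneTest

end

/-! Since `h P' > 0`, the quotient `M / W` over a cell is a weighted average of `ξ`. So all moments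
are nonpositive when `ξ` is increasing (`nu_nonpos_of_monotoneOn`), and by continuity of `ξ` a
decrease shows up on a fine enough grid (`exists_nu_pos`).

The numerator of a studentized moment is the estimation noise plus the drift `√S ν`. Slack moments
drift to `-∞`, but not uniformly over the infinite index set, so the limit is reached by a sandwich.
Let `U` be the square root of the Cramér–von Mises functional with the limit weights, restricted to
moments with `ν ≥ 0`. Let `Uₙ` keep all weights and push finitely many slack moments down by `n`, so
that `Uₙ ↓ U`. Under the null hypothesis the test statistic lies asymptotically between `U²` and
`Uₙ²` (`le_testStat`, `testStat_le`). Under either hypothesis so does the bootstrap statistic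
(`le_bootStat`, `bootStat_le`), because moment selection spares all nonnegative moments and hits any
finite set of negative ones. The roots are Lipschitz for the supremum norm
(`lipschitzWith_cvmRoot`), so both kinds of weak convergence apply to them.

Under the null hypothesis the critical value tends to `q² + η`, with `q` the `(1 - α + η)`-quantile
of `U` under `Γ`. This needs `q` to be crossed strictly, hence mass of `U` just below `q`
(`cvmRoot_window_ne_zero`); convergence of the rejection probability needs no atom at `√(q² + η)`
(`cvmRoot_level_null`). Both follow from `null_iff_line`: freeze the residuals of a regression on
one coordinate and use convexity along the remaining line. The limit `Γ(U² > q² + η)` is below `α -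
η`. If no moment kept in `U` has positive variance, `U` vanishes almost surely, and the summand `η`
in the critical value drives the rejection probability to zero.

Under the alternative the critical value stays bounded, by comparison with `U₀`, while a single
positive moment makes the statistic diverge. -/

namespace MonotoneTest

/-! ### Convexity of the Cramér–von Mises functional, in particular along lines. -/

section Functional

variable {I : Type} {w w' z z' : I → ℝ}

lemma cvm_le_cvm (h : ∀ p, (max (z p) 0) ^ 2 * w p ≤ (max (z' p) 0) ^ 2 * w' p) :
    cvm w z ≤ cvm w' z' :=
  ENNReal.tsum_le_tsum fun p => ENNReal.ofReal_le_ofReal (h p)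

lemma cvm_mono (hw : ∀ p, 0 ≤ w p) (h : ∀ p, z p ≤ z' p) : cvm w z ≤ cvm w z' :=
  cvm_le_cvm fun p => mul_le_mul_of_nonneg_right
    (pow_le_pow_left₀ (le_max_right _ _) (max_le_max_right 0 (h p)) 2) (hw p)

lemma cvm_const_mul {c : ℝ} (hc : 0 ≤ c) :
    cvm (fun p => c * w p) z = ENNReal.ofReal c * cvm w z := by
  unfold cvm
  rw [← ENNReal.tsum_mul_left]
  refine tsum_congr fun p => ?_
  rw [← ENNReal.ofReal_mul hc]
  ring_nf

/-- Studentization moves into the weights, where an estimated variance is only a perturbation. -/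
lemma cvm_div {s : I → ℝ} (hs : ∀ p, 0 < s p) :
    cvm w (fun p => z p / s p) = cvm (fun p => w p / s p ^ 2) z := by
  unfold cvm
  refine tsum_congr fun p => ?_
  have : max (z p / s p) 0 = max (z p) 0 / s p := by
    rw [← zero_div (s p), max_div_div_right (hs p).le, zero_div]
  rw [this, div_pow]
  ring_nf

lemma summable_of_cvm_ne_top (hw : ∀ p, 0 ≤ w p) (h : cvm w z ≠ ∞) :
    Summable fun p => (max (z p) 0) ^ 2 * w p := by
  have := ENNReal.summable_toReal h
  refine this.congr fun p => ?_
  rw [ENNReal.toReal_ofReal]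
  have := hw p
  positivity

lemma cvm_eq_ofReal (hw : ∀ p, 0 ≤ w p) (h : Summable fun p => (max (z p) 0) ^ 2 * w p) :
    cvm w z = ENNReal.ofReal (∑' p, (max (z p) 0) ^ 2 * w p) := by
  rw [ENNReal.ofReal_tsum_of_nonneg _ h]
  · rfl
  · intro p
    have := hw p
    positivity

lemma sq_max_convex {x y t : ℝ} (ht0 : 0 ≤ t) (ht1 : t ≤ 1) :
    (max (t * x + (1 - t) * y) 0) ^ 2 ≤ t * (max x 0) ^ 2 + (1 - t) * (max y 0) ^ 2 := by
  have h1 : max (t * x + (1 - t) * y) 0 ≤ t * max x 0 + (1 - t) * max y 0 := by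
    have := le_max_left x 0
    have := le_max_left y 0
    have := le_max_right x 0
    have := le_max_right y 0
    have : 0 ≤ 1 - t := by linarith
    apply max_le
    · gcongr
    · positivity
  have h2 := pow_le_pow_left₀ (le_max_right _ _) h1 2
  nlinarith [mul_nonneg (mul_nonneg ht0 (sub_nonneg.2 ht1)) (sq_nonneg (max x 0 - max y 0))]

/-- Positivity of both points is essential: the squared positive part is flat on the negative
half-line. -/
lemma sq_max_strictConvex {x y t : ℝ} (ht0 : 0 < t) (ht1 : t < 1) (hx : 0 < x) (hy : 0 < y)
    (hxy : x ≠ y) :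
    (max (t * x + (1 - t) * y) 0) ^ 2 < t * (max x 0) ^ 2 + (1 - t) * (max y 0) ^ 2 := by
  have h1 : 0 < 1 - t := by linarith
  rw [max_eq_left hx.le, max_eq_left hy.le, max_eq_left (by positivity)]
  have : 0 < (x - y) ^ 2 := by
    have := sub_ne_zero.2 hxy
    positivity
  nlinarith [mul_pos (mul_pos ht0 h1) this]

variable (w) in
/-- The Cramér–von Mises functional as a real series. -/
noncomputable def cvmReal (z : I → ℝ) : ℝ := ∑' p, (max (z p) 0) ^ 2 * w p

lemma summable_sq_max_combo (hw : ∀ p, 0 ≤ w p)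
    (hx : Summable fun p => (max (z p) 0) ^ 2 * w p)
    (hy : Summable fun p => (max (z' p) 0) ^ 2 * w p) {t : ℝ} (ht0 : 0 ≤ t) (ht1 : t ≤ 1) :
    Summable fun p => (max (t * z p + (1 - t) * z' p) 0) ^ 2 * w p := by
  refine Summable.of_nonneg_of_le (fun p => ?_) (fun p => ?_)
    ((hx.mul_left t).add (hy.mul_left (1 - t)))
  · have := hw p
    positivity
  · have := mul_le_mul_of_nonneg_right (sq_max_convex (x := z p) (y := z' p) ht0 ht1) (hw p)
    linarith

lemma cvmReal_convex (hw : ∀ p, 0 ≤ w p)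
    (hx : Summable fun p => (max (z p) 0) ^ 2 * w p)
    (hy : Summable fun p => (max (z' p) 0) ^ 2 * w p) {t : ℝ} (ht0 : 0 ≤ t) (ht1 : t ≤ 1) :
    cvmReal w (fun p => t * z p + (1 - t) * z' p) ≤ t * cvmReal w z + (1 - t) * cvmReal w z' := by
  unfold cvmReal
  rw [← tsum_mul_left, ← tsum_mul_left, ← (hx.mul_left t).tsum_add (hy.mul_left (1 - t))]
  refine Summable.tsum_le_tsum (fun p => ?_) (summable_sq_max_combo hw hx hy ht0 ht1)
    ((hx.mul_left t).add (hy.mul_left (1 - t)))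
  have := mul_le_mul_of_nonneg_right (sq_max_convex (x := z p) (y := z' p) ht0 ht1) (hw p)
  linarith

lemma cvmReal_strictConvex (hw : ∀ p, 0 ≤ w p)
    (hx : Summable fun p => (max (z p) 0) ^ 2 * w p)
    (hy : Summable fun p => (max (z' p) 0) ^ 2 * w p) {t : ℝ} (ht0 : 0 < t) (ht1 : t < 1)
    {p₀ : I} (hp : 0 < w p₀) (hzp : 0 < z p₀) (hzp' : 0 < z' p₀) (hne : z p₀ ≠ z' p₀) :
    cvmReal w (fun p => t * z p + (1 - t) * z' p) < t * cvmReal w z + (1 - t) * cvmReal w z' := by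
  unfold cvmReal
  rw [← tsum_mul_left, ← tsum_mul_left, ← (hx.mul_left t).tsum_add (hy.mul_left (1 - t))]
  refine Summable.tsum_lt_tsum (i := p₀) (fun p => ?_) ?_
    (summable_sq_max_combo hw hx hy ht0.le ht1.le) ((hx.mul_left t).add (hy.mul_left (1 - t)))
  · have := mul_le_mul_of_nonneg_right (sq_max_convex (x := z p) (y := z' p) ht0.le ht1.le) (hw p)
    linarith
  · have := mul_lt_mul_of_pos_right (sq_max_strictConvex ht0 ht1 hzp hzp' hne) hp
    linarith

/-- Along a line whose `p₀` coordinate moves, a level set of the Cramér–von Mises functional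
within `{p₀ coordinate > 0}` is finite. -/
lemma finite_level_line (hw : ∀ p, 0 ≤ w p) {p₀ : I} (hp : 0 < w p₀) (y a : I → ℝ)
    (ha : 0 < a p₀) (c : ℝ) :
    {s : ℝ | cvm w (fun p => y p + s * a p) = ENNReal.ofReal c ∧ 0 < y p₀ + s * a p₀}.Finite := by
  by_contra hinf
  -- Three points suffice: strict convexity forbids the same value at three points of the line.
  obtain ⟨F, hFs, hF3⟩ := Set.Infinite.exists_subset_card_eq (s := _) hinf 3
  have key : ∀ s1 s2 s3 : ℝ, s1 ∈ F → s2 ∈ F → s3 ∈ F → s1 < s2 → s2 < s3 → False := by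
    intro s1 s2 s3 h1 h2 h3 h12 h23
    obtain ⟨e1, g1⟩ := hFs h1
    obtain ⟨e2, g2⟩ := hFs h2
    obtain ⟨e3, g3⟩ := hFs h3
    -- The level is finite, so the series converge and the real-valued convexity inequality is
    -- available.
    have S1 := summable_of_cvm_ne_top hw (e1 ▸ ENNReal.ofReal_ne_top)
    have S2 := summable_of_cvm_ne_top hw (e2 ▸ ENNReal.ofReal_ne_top)
    have S3 := summable_of_cvm_ne_top hw (e3 ▸ ENNReal.ofReal_ne_top)
    have nn : ∀ x : I → ℝ, 0 ≤ cvmReal w x := fun x => tsum_nonneg fun p => by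
      have := hw p
      positivity
    have E12 : cvmReal w (fun p => y p + s1 * a p) = cvmReal w (fun p => y p + s2 * a p) := by
      rw [cvm_eq_ofReal hw S1, ← e2, cvm_eq_ofReal hw S2] at e1
      exact (ENNReal.ofReal_eq_ofReal_iff (nn _) (nn _)).1 e1
    have E32 : cvmReal w (fun p => y p + s3 * a p) = cvmReal w (fun p => y p + s2 * a p) := by
      rw [cvm_eq_ofReal hw S3, ← e2, cvm_eq_ofReal hw S2] at e3
      exact (ENNReal.ofReal_eq_ofReal_iff (nn _) (nn _)).1 e3
    have h13 : 0 < s3 - s1 := by linarith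
    have hlt := cvmReal_strictConvex hw S1 S3 (t := (s3 - s2) / (s3 - s1))
      (by apply div_pos <;> linarith) (by rw [div_lt_one h13]; linarith) hp g1 g3
      (by
        have := mul_lt_mul_of_pos_right (h12.trans h23) ha
        exact ne_of_lt (by linarith))
    have heq : (fun p => (s3 - s2) / (s3 - s1) * (y p + s1 * a p)
        + (1 - (s3 - s2) / (s3 - s1)) * (y p + s3 * a p)) = fun p => y p + s2 * a p := by
      funext p
      field_simp
      ring
    rw [heq, E12, E32] at hlt
    linarith
  exact key (F.orderEmbOfFin hF3 0) (F.orderEmbOfFin hF3 1) (F.orderEmbOfFin hF3 2)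
    (F.orderEmbOfFin_mem hF3 0) (F.orderEmbOfFin_mem hF3 1) (F.orderEmbOfFin_mem hF3 2)
    ((F.orderEmbOfFin hF3).strictMono (by decide)) ((F.orderEmbOfFin hF3).strictMono (by decide))

/-- Every point of the line is an affine combination of two given ones. The coefficients may be
negative, which is why full squares, not positive parts, are assumed summable. -/
lemma summable_line (hw : ∀ p, 0 ≤ w p) (y a : I → ℝ) {s1 s2 : ℝ} (h12 : s1 ≠ s2)
    (h1 : Summable fun p => (y p + s1 * a p) ^ 2 * w p)
    (h2 : Summable fun p => (y p + s2 * a p) ^ 2 * w p) (s : ℝ) :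
    Summable fun p => (max (y p + s * a p) 0) ^ 2 * w p := by
  set t := (s - s2) / (s1 - s2) with ht
  have hne := sub_ne_zero.2 h12
  refine Summable.of_nonneg_of_le (fun p => ?_) (fun p => ?_)
    ((h1.mul_left (2 * t ^ 2)).add (h2.mul_left (2 * (1 - t) ^ 2)))
  · have := hw p
    positivity
  · have e : y p + s * a p = t * (y p + s1 * a p) + (1 - t) * (y p + s2 * a p) := by
      rw [ht]
      field_simp
      ring
    have e1 : (max (y p + s * a p) 0) ^ 2 ≤ (y p + s * a p) ^ 2 := by
      rcases le_total (y p + s * a p) 0 with h | h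
      · rw [max_eq_right h, zero_pow two_ne_zero]
        positivity
      · rw [max_eq_left h]
    have e2 : (y p + s * a p) ^ 2 ≤ 2 * t ^ 2 * (y p + s1 * a p) ^ 2
        + 2 * (1 - t) ^ 2 * (y p + s2 * a p) ^ 2 := by
      rw [e]
      nlinarith [sq_nonneg (t * (y p + s1 * a p) - (1 - t) * (y p + s2 * a p))]
    have := mul_le_mul_of_nonneg_right (e1.trans e2) (hw p)
    linarith

/-- A finite convex function on the real line is continuous. -/
lemma continuous_cvmReal_line (hw : ∀ p, 0 ≤ w p) (y a : I → ℝ)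
    (h : ∀ s : ℝ, Summable fun p => (max (y p + s * a p) 0) ^ 2 * w p) :
    Continuous fun s : ℝ => cvmReal w fun p => y p + s * a p := by
  rw [← continuousOn_univ]
  refine ConvexOn.continuousOn isOpen_univ ⟨convex_univ, ?_⟩
  intro s1 _ s2 _ t t' ht ht' htt
  have h1 : t' = 1 - t := by linarith
  have := cvmReal_convex hw (h s1) (h s2) ht (by linarith : t ≤ 1)
  simp only [smul_eq_mul]
  have e : (fun p => y p + (t * s1 + t' * s2) * a p)
      = fun p => t * (y p + s1 * a p) + (1 - t) * (y p + s2 * a p) := by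
    funext p
    rw [h1]
    ring
  rw [e, h1]
  exact this

lemma tendsto_cvmReal_line (hw : ∀ p, 0 ≤ w p) {p₀ : I} (hp : 0 < w p₀) (y a : I → ℝ)
    (ha : 0 < a p₀) (h : ∀ s : ℝ, Summable fun p => (max (y p + s * a p) 0) ^ 2 * w p) :
    Tendsto (fun s : ℝ => cvmReal w fun p => y p + s * a p) atTop atTop := by
  have h1 : Tendsto (fun s : ℝ => (y p₀ + s * a p₀) ^ 2 * w p₀) atTop atTop := by
    refine Tendsto.atTop_mul_const hp ?_
    refine (tendsto_pow_atTop two_ne_zero).comp ?_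
    exact tendsto_atTop_add_const_left _ _ (tendsto_id.atTop_mul_const ha)
  refine tendsto_atTop_mono' _ ?_ h1
  filter_upwards [eventually_ge_atTop (-y p₀ / a p₀)] with s hs
  have hpos : 0 ≤ y p₀ + s * a p₀ := by
    rw [div_le_iff₀ ha] at hs
    linarith
  refine le_trans ?_ ((h s).le_tsum p₀ fun p _ => ?_)
  · rw [max_eq_left hpos]
  · have := hw p
    positivity

end Functional

/-! ### The root functional on `ℓ^∞` and its Lipschitz property. -/

section Root

variable {I : Type} {w c : I → ℝ}

variable (w c) in
/-- Square root of the Cramér–von Mises functional of `z + c`. -/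
noncomputable def cvmRoot (z : Linf I) : ℝ := √(cvmReal w fun p => z p + c p)

lemma abs_coord_le (z : Linf I) (p : I) : |z p| ≤ ‖z‖ := lp.norm_apply_le_norm ENNReal.top_ne_zero z p

lemma max_add_le (hc : ∀ p, c p ≤ 0) (z : Linf I) (p : I) : max (z p + c p) 0 ≤ ‖z‖ := by
  refine max_le ?_ (norm_nonneg z)
  have := (abs_le.1 (abs_coord_le z p)).2
  linarith [hc p]

lemma summable_shift (hw : ∀ p, 0 ≤ w p) (hs : Summable w) (hc : ∀ p, c p ≤ 0) (z : Linf I) :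
    Summable fun p => (max (z p + c p) 0) ^ 2 * w p := by
  refine Summable.of_nonneg_of_le (fun p => ?_) (fun p => ?_) (hs.mul_left (‖z‖ ^ 2))
  · have := hw p
    positivity
  · exact mul_le_mul_of_nonneg_right
      (pow_le_pow_left₀ (le_max_right _ _) (max_add_le hc z p) 2) (hw p)

lemma cvmRoot_nonneg (z : Linf I) : 0 ≤ cvmRoot w c z := Real.sqrt_nonneg _

lemma cvmReal_nonneg (hw : ∀ p, 0 ≤ w p) (x : I → ℝ) : 0 ≤ cvmReal w x :=
  tsum_nonneg fun p => by
    have := hw p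
    positivity

lemma cvm_eq_cvmRoot (hw : ∀ p, 0 ≤ w p) (hs : Summable w) (hc : ∀ p, c p ≤ 0) (z : Linf I) :
    cvm w (fun p => z p + c p) = ENNReal.ofReal (cvmRoot w c z ^ 2) := by
  rw [cvm_eq_ofReal hw (summable_shift hw hs hc z), cvmRoot, Real.sq_sqrt (cvmReal_nonneg hw _)]
  rfl

/-- Minkowski's inequality in weighted `ℓ²`: the positive part of `z + c` exceeds that of `z' + c`
by at most the constant `dist z z'`. Nonpositive shifts keep the series finite. -/
lemma cvmRoot_le_add (hw : ∀ p, 0 ≤ w p) (hs : Summable w) (hc : ∀ p, c p ≤ 0) (z z' : Linf I) :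
    cvmRoot w c z ≤ cvmRoot w c z' + √(∑' p, w p) * dist z z' := by
  set d := dist z z'
  have hd : 0 ≤ d := dist_nonneg
  set W := ∑' p, w p
  have hW : 0 ≤ W := tsum_nonneg hw
  set b : I → ℝ := fun p => max (z' p + c p) 0 with hb
  have hb0 : ∀ p, 0 ≤ b p := fun p => le_max_right _ _
  have S2 : Summable fun p => b p ^ 2 * w p := summable_shift hw hs hc z'
  have S1 : Summable fun p => b p * w p := by
    refine Summable.of_nonneg_of_le (fun p => mul_nonneg (hb0 p) (hw p)) (fun p => ?_)
      (hs.mul_left ‖z'‖)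
    exact mul_le_mul_of_nonneg_right (max_add_le hc z' p) (hw p)
  set A := ∑' p, b p * w p
  set F := ∑' p, b p ^ 2 * w p with hF
  have hFR : √F = cvmRoot w c z' := rfl
  have hF0 : 0 ≤ F := cvmReal_nonneg hw _
  have CS : A ≤ √F * √W := by
    -- Cauchy–Schwarz from the discriminant of the quadratic `∑ (b p - t)² w p` in `t`.
    have hq : ∀ t : ℝ, 0 ≤ W * (t * t) + (-2 * A) * t + F := by
      intro t
      have h0 : 0 ≤ ∑' p, (b p - t) ^ 2 * w p := tsum_nonneg fun p => by
        have := hw p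
        positivity
      have e : ∑' p, (b p - t) ^ 2 * w p = F - 2 * t * A + t ^ 2 * W := by
        rw [← tsum_mul_left, ← tsum_mul_left, hF, ← S2.tsum_sub (S1.mul_left _),
          ← (S2.sub (S1.mul_left _)).tsum_add (hs.mul_left _)]
        exact tsum_congr fun p => by ring
      rw [e] at h0
      linarith
    have hdisc := discrim_le_zero hq
    rw [discrim] at hdisc
    rw [← Real.sqrt_mul hF0]
    exact Real.le_sqrt_of_sq_le (by nlinarith)
  have hle : cvmReal w (fun p => z p + c p) ≤ F + 2 * d * A + d ^ 2 * W := by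
    rw [← tsum_mul_left, ← tsum_mul_left, hF, ← S2.tsum_add (S1.mul_left _),
      ← (S2.add (S1.mul_left _)).tsum_add (hs.mul_left _)]
    refine Summable.tsum_le_tsum (fun p => ?_) (summable_shift hw hs hc z)
      ((S2.add (S1.mul_left _)).add (hs.mul_left _))
    have h1 : z p ≤ z' p + d := by
      have := (abs_le.1 (abs_coord_le (z - z') p)).2
      rw [← dist_eq_norm] at this
      have e : (z - z') p = z p - z' p := rfl
      rw [e] at this
      linarith
    have h2 : max (z p + c p) 0 ≤ b p + d := by
      apply max_le
      · have := le_max_left (z' p + c p) 0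
        simp only [hb]
        linarith
      · have := hb0 p
        positivity
    have h3 := mul_le_mul_of_nonneg_right (pow_le_pow_left₀ (le_max_right _ _) h2 2) (hw p)
    linarith
  rw [← hFR]
  refine Real.sqrt_le_iff.2 ⟨by positivity, hle.trans ?_⟩
  have e1 := Real.sq_sqrt hF0
  have e2 := Real.sq_sqrt hW
  have e3 : 2 * d * A ≤ 2 * d * (√F * √W) := by gcongr
  calc F + 2 * d * A + d ^ 2 * W ≤ F + 2 * d * (√F * √W) + d ^ 2 * W := by linarith
    _ = √F ^ 2 + 2 * d * (√F * √W) + d ^ 2 * √W ^ 2 := by rw [e1, e2]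
    _ = (√F + √W * d) ^ 2 := by ring

lemma lipschitzWith_cvmRoot (hw : ∀ p, 0 ≤ w p) (hs : Summable w) (hc : ∀ p, c p ≤ 0) :
    LipschitzWith (Real.toNNReal √(∑' p, w p)) (cvmRoot w c) := by
  refine LipschitzWith.of_le_add_mul _ fun z z' => ?_
  rw [Real.coe_toNNReal _ (Real.sqrt_nonneg _)]
  exact cvmRoot_le_add hw hs hc z z'

lemma measurable_cvmRoot (hw : ∀ p, 0 ≤ w p) (hs : Summable w) (hc : ∀ p, c p ≤ 0) :
    Measurable (cvmRoot w c) :=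
  (lipschitzWith_cvmRoot hw hs hc).continuous.measurable

end Root

/-! ### The law of the root functional under the Gaussian limit. -/

section Gaussian

variable {I : Type} {Γ : Measure (Linf I)} {κ : I → I → ℝ} {w : I → ℝ}

lemma continuous_coord (p : I) : Continuous fun z : Linf I => z p := by
  refine (LipschitzWith.of_dist_le_mul (K := 1) fun z z' => ?_).continuous
  rw [NNReal.coe_one, one_mul, dist_eq_norm, dist_eq_norm]
  exact abs_coord_le (z - z') p

lemma measurable_coord (p : I) : Measurable fun z : Linf I => z p := (continuous_coord p).measurable

lemma measurable_cvm [Countable I] : Measurable fun x : I → ℝ => cvm w x := by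
  unfold cvm
  refine Measurable.tsum fun p => ?_
  exact ((((measurable_pi_apply p).max measurable_const).pow_const 2).mul_const _).ennreal_ofReal

lemma IsGaussianLaw.memLp (hΓ : IsGaussianLaw Γ κ) (p : I) : MemLp (fun z : Linf I => z p) 2 Γ :=
  (hΓ.gaussian.hasGaussianLaw_eval p).memLp_two

lemma IsGaussianLaw.variance_eq (hΓ : IsGaussianLaw Γ κ) (p : I) :
    variance (fun z : Linf I => z p) Γ = κ p p := by
  rw [← covariance_self (measurable_coord p).aemeasurable, hΓ.cov]

lemma IsGaussianLaw.map_coord (hΓ : IsGaussianLaw Γ κ) (p : I) :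
    Γ.map (fun z : Linf I => z p) = gaussianReal 0 (κ p p).toNNReal := by
  rw [(hΓ.gaussian.hasGaussianLaw_eval p).map_eq_gaussianReal, hΓ.variance_eq, hΓ.mean]

lemma IsGaussianLaw.var_nonneg (hΓ : IsGaussianLaw Γ κ) (p : I) : 0 ≤ κ p p := by
  rw [← hΓ.variance_eq]
  exact variance_nonneg _ _

lemma IsGaussianLaw.ae_eq_zero (hΓ : IsGaussianLaw Γ κ) {p : I} (hp : κ p p = 0) :
    ∀ᵐ z : Linf I ∂Γ, z p = 0 := by
  have h := hΓ.map_coord p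
  rw [hp, Real.toNNReal_zero, gaussianReal_zero_var] at h
  have h2 : ∀ᵐ x : ℝ ∂(Γ.map fun z : Linf I => z p), x = 0 := by
    rw [h]
    exact (ae_dirac_iff (measurableSet_singleton (0 : ℝ))).2 rfl
  exact ae_of_ae_map (measurable_coord p).aemeasurable h2

lemma IsGaussianLaw.coord_nonpos_le_half (hΓ : IsGaussianLaw Γ κ) {p : I} (hp : 0 < κ p p) :
    Γ.real {z : Linf I | z p ≤ 0} ≤ 1 / 2 := by
  have hv : (κ p p).toNNReal ≠ 0 := by simpa using hp
  have e : Γ.real {z : Linf I | z p ≤ 0} = (gaussianReal 0 (κ p p).toNNReal).real (Iic 0) := by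
    rw [← hΓ.map_coord p, map_measureReal_apply (measurable_coord p) measurableSet_Iic]
    rfl
  rw [e]
  set g := gaussianReal 0 (κ p p).toNNReal
  have hsymm : g.real (Iic 0) = g.real (Ici 0) := by
    have : g.map (fun x => -x) = g := by
      simp only [g, gaussianReal_map_neg, neg_zero]
    conv_lhs => rw [← this]
    rw [map_measureReal_apply measurable_neg measurableSet_Iic]
    congr 1
    ext x
    simp
  have := nullSingletonClass_gaussianReal (μ := 0) hv
  have hI : g.real (Ici 0) = g.real (Ioi 0) := measureReal_congr Ioi_ae_eq_Ici.symm
  have h1 : g.real (Iic 0) + g.real (Ioi 0) = 1 := by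
    rw [← compl_Iic, measureReal_compl measurableSet_Iic]
    simp
  linarith

/-- Conditioning a Gaussian law on all but one direction: a coordinate event is null iff almost
every line in that direction meets it in a null set. -/
lemma IsGaussianLaw.null_iff_line (hΓ : IsGaussianLaw Γ κ) {p₀ : I} (hp : 0 < κ p₀ p₀)
    {A : Set (I → ℝ)} (hA : MeasurableSet A) :
    Γ {z : Linf I | (fun p => z p) ∈ A} = 0 ↔
      ∀ᵐ y ∂(Γ.map fun (z : Linf I) (p : I) => z p - κ p p₀ / κ p₀ p₀ * z p₀),
        gaussianReal 0 (κ p₀ p₀).toNNReal {s | (fun p => y p + s * (κ p p₀ / κ p₀ p₀)) ∈ A} = 0 := by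
  have := hΓ.isProbabilityMeasure
  set a : I → ℝ := fun p => κ p p₀ / κ p₀ p₀
  set Y : Linf I → I → ℝ := fun z p => z p - a p * z p₀
  have hY : Measurable Y := measurable_pi_lambda _ fun p =>
    (measurable_coord p).sub ((measurable_coord p₀).const_mul _)
  have hX := measurable_coord p₀
  -- The residuals and the regressor are jointly Gaussian, being linear in finitely many
  -- coordinates; the choice of `a` makes them uncorrelated, hence independent.
  have hG : IsGaussianProcess (Sum.elim (fun (p : I) (z : Linf I) => z p - a p * z p₀)
      (fun (_ : Unit) (z : Linf I) => z p₀)) Γ := by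
    classical
    refine hΓ.gaussian.of_isGaussianProcess fun t => ?_
    cases t with
    | inl p =>
      exact ⟨{p₀, p},
        { toFun x := x ⟨p, by simp⟩ - a p * x ⟨p₀, by simp⟩
          map_add' x y := by simp; ring
          map_smul' c x := by simp; ring }, by simp⟩
    | inr u =>
      exact ⟨{p₀},
        { toFun x := x ⟨p₀, by simp⟩
          map_add' x y := by simp
          map_smul' c x := by simp }, by simp⟩
  have hind0 := hG.indepFun_of_covariance_eq_zero
    (fun p => ((measurable_coord p).sub ((measurable_coord p₀).const_mul _)).aemeasurable)
    (fun _ => hX.aemeasurable) (fun p _ => by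
      rw [covariance_fun_sub_left (hΓ.memLp p) ((hΓ.memLp p₀).const_mul _) (hΓ.memLp p₀),
        covariance_const_mul_left, hΓ.cov, hΓ.cov]
      simp only [a]
      field_simp
      ring)
  have hind : IndepFun Y (fun z : Linf I => z p₀) Γ :=
    hind0.comp (φ := id) (ψ := fun f : Unit → ℝ => f ()) measurable_id (measurable_pi_apply _)
  have hprod := hind.map_prod_eq_prod_map_map hY.aemeasurable hX.aemeasurable
  rw [hΓ.map_coord p₀] at hprod
  set F : (I → ℝ) × ℝ → I → ℝ := fun q p => q.1 p + q.2 * a p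
  have hF : Measurable F := measurable_pi_lambda _ fun p =>
    ((measurable_pi_apply p).comp measurable_fst).add (measurable_snd.mul_const _)
  have hset : {z : Linf I | (fun p => z p) ∈ A} = (fun z => (Y z, z p₀)) ⁻¹' (F ⁻¹' A) := by
    ext z
    have : F (Y z, z p₀) = fun p => z p := by
      funext p
      simp only [F, Y]
      ring
    simp only [mem_ofPred_eq, mem_preimage, this]
  rw [hset, ← Measure.map_apply (hY.prodMk hX) (hF hA), hprod, Measure.measure_prod_null (hF hA)]
  rfl

lemma cvmRoot_zero_eq : cvmRoot w (fun _ => 0) = fun z : Linf I => √(cvmReal w fun p => z p) := by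
  funext z
  simp [cvmRoot]

lemma cvm_coe_eq (hw : ∀ p, 0 ≤ w p) (hs : Summable w) (z : Linf I) :
    cvm w (fun p => z p) = ENNReal.ofReal (cvmRoot w (fun _ => 0) z ^ 2) := by
  rw [← cvm_eq_cvmRoot hw hs (fun _ => le_rfl)]
  simp

lemma cvmRoot_eq_zero {z : Linf I} (h : ∀ p, w p = 0 ∨ z p ≤ 0) :
    cvmRoot w (fun _ => 0) z = 0 := by
  rw [cvmRoot_zero_eq]
  have : cvmReal w (fun p => z p) = 0 := by
    refine (tsum_congr fun p => ?_).trans tsum_zero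
    rcases h p with h | h
    · rw [h, mul_zero]
    · simp only [max_eq_right h]
      ring
  simp only [this, Real.sqrt_zero]

/-- Coordinates of zero variance vanish almost surely, simultaneously because the index set is
countable. -/
lemma IsGaussianLaw.ae_cvmRoot_eq_zero [Countable I] (hΓ : IsGaussianLaw Γ κ)
    (h : ∀ p, w p = 0 ∨ κ p p = 0) : ∀ᵐ z ∂Γ, cvmRoot w (fun _ => 0) z = 0 := by
  have h1 : ∀ᵐ z : Linf I ∂Γ, ∀ p, κ p p = 0 → z p = 0 := by
    rw [ae_all_iff]
    intro p
    by_cases hp : κ p p = 0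
    · filter_upwards [hΓ.ae_eq_zero hp] with z hz _ using hz
    · exact Eventually.of_forall fun z hz => absurd hz hp
  filter_upwards [h1] with z hz
  exact cvmRoot_eq_zero fun p => (h p).imp id fun h => (hz p h).le

/-- A zero value of the functional forces the `p₀` coordinate to be nonpositive, an event of
probability at most one half. Levels above one half therefore have positive quantiles. -/
lemma IsGaussianLaw.cvmRoot_nonpos_le_half (hΓ : IsGaussianLaw Γ κ) (hw : ∀ p, 0 ≤ w p)
    (hs : Summable w) {p₀ : I} (hwp : 0 < w p₀) (hp : 0 < κ p₀ p₀) :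
    Γ.real {z | cvmRoot w (fun _ => 0) z ≤ 0} ≤ 1 / 2 := by
  have := hΓ.isProbabilityMeasure
  refine le_trans (measureReal_mono fun z hz => ?_) (hΓ.coord_nonpos_le_half hp)
  by_contra hpos
  simp only [mem_ofPred_eq, not_le] at hpos hz
  rw [cvmRoot_zero_eq] at hz
  have h1 := Real.sqrt_eq_zero'.1 (le_antisymm hz (Real.sqrt_nonneg _))
  have S := summable_shift hw hs (c := fun _ => 0) (fun _ => le_rfl) z
  simp only [add_zero] at S
  have h2 := S.le_tsum p₀ fun p _ => by
    have := hw p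
    positivity
  rw [max_eq_left hpos.le] at h2
  have h3 : 0 < z p₀ ^ 2 * w p₀ := by positivity
  unfold cvmReal at h1
  linarith

/-- A positive value requires a positive coordinate of positive weight, almost surely one of
positive variance. For each such coordinate, the lines of `null_iff_line` meet the level set in
finitely many points (`finite_level_line`), and countably many coordinates are involved. -/
lemma IsGaussianLaw.cvmRoot_level_null [Countable I] (hΓ : IsGaussianLaw Γ κ)
    (hw : ∀ p, 0 ≤ w p) (hs : Summable w) {t : ℝ} (ht : 0 < t) :
    Γ {z | cvmRoot w (fun _ => 0) z = t} = 0 := by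
  have key : ∀ p₀, 0 < w p₀ ∧ 0 < κ p₀ p₀ →
      Γ {z : Linf I | cvm w (fun p => z p) = ENNReal.ofReal (t ^ 2) ∧ 0 < z p₀} = 0 := by
    rintro p₀ ⟨hwp, hp⟩
    have hA : MeasurableSet {x : I → ℝ | cvm w x = ENNReal.ofReal (t ^ 2) ∧ 0 < x p₀} :=
      (measurableSet_eq_fun measurable_cvm measurable_const).inter
        (measurableSet_lt measurable_const (measurable_pi_apply p₀))
    refine (hΓ.null_iff_line hp hA).2 (Eventually.of_forall fun y => ?_)
    have hv : (κ p₀ p₀).toNNReal ≠ 0 := by simpa using hp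
    have := nullSingletonClass_gaussianReal (μ := 0) hv
    exact (finite_level_line hw hwp y _ (by positivity) _).measure_zero _
  have h1 : ∀ᵐ z : Linf I ∂Γ, ∀ p, 0 < w p ∧ 0 < κ p p →
      ¬ (cvm w (fun p => z p) = ENNReal.ofReal (t ^ 2) ∧ 0 < z p) := by
    rw [ae_all_iff]
    intro p
    by_cases hp : 0 < w p ∧ 0 < κ p p
    · have : ∀ᵐ z : Linf I ∂Γ, ¬ (cvm w (fun p => z p) = ENNReal.ofReal (t ^ 2) ∧ 0 < z p) := by
        rw [ae_iff]
        simpa only [not_not] using key p hp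
      filter_upwards [this] with z hz _ using hz
    · exact Eventually.of_forall fun z hz => absurd hz hp
  have h2 : ∀ᵐ z : Linf I ∂Γ, ∀ p, κ p p = 0 → z p = 0 := by
    rw [ae_all_iff]
    intro p
    by_cases hp : κ p p = 0
    · filter_upwards [hΓ.ae_eq_zero hp] with z hz _ using hz
    · exact Eventually.of_forall fun z hz => absurd hz hp
  have h3 : ∀ᵐ z ∂Γ, ¬ cvmRoot w (fun _ => 0) z = t := by
    filter_upwards [h1, h2] with z hz1 hz2 he
    refine ht.ne' (he.symm.trans (cvmRoot_eq_zero fun p => ?_))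
    by_contra hcon
    push Not at hcon
    have hwp := (hw p).lt_of_ne' hcon.1
    have hkp := (hΓ.var_nonneg p).lt_of_ne' fun h => hcon.2.ne' (hz2 p h)
    exact hz1 p ⟨hwp, hkp⟩ ⟨by rw [cvm_coe_eq hw hs, he], hcon.2⟩
  rw [ae_iff] at h3
  simpa only [not_not] using h3

/-- The law of the functional has no gap below a level it undercuts with positive probability. Along
a line in the `p₀` direction the functional is continuous and tends to infinity, so a line that
enters `{U < q}` crosses the window in a nonempty open set. -/
lemma IsGaussianLaw.cvmRoot_window_ne_zero [Countable I] (hΓ : IsGaussianLaw Γ κ)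
    (hw : ∀ p, 0 ≤ w p) (hs : Summable w) {p₀ : I} (hwp : 0 < w p₀) (hp : 0 < κ p₀ p₀)
    {u q : ℝ} (hu : 0 ≤ u) (huq : u < q) (hq : Γ {z | cvmRoot w (fun _ => 0) z < q} ≠ 0) :
    Γ {z | u < cvmRoot w (fun _ => 0) z ∧ cvmRoot w (fun _ => 0) z < q} ≠ 0 := by
  intro h0
  apply hq
  have hq0 : 0 < q := hu.trans_lt huq
  have hv : (κ p₀ p₀).toNNReal ≠ 0 := by simpa using hp
  set g := gaussianReal 0 (κ p₀ p₀).toNNReal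
  have iff1 : ∀ z : Linf I, cvm w (fun p => z p) < ENNReal.ofReal (q ^ 2) ↔
      cvmRoot w (fun _ => 0) z < q := fun z => by
    rw [cvm_coe_eq hw hs, ENNReal.ofReal_lt_ofReal_iff (by positivity),
      pow_lt_pow_iff_left₀ (cvmRoot_nonneg z) hq0.le two_ne_zero]
  have iff2 : ∀ z : Linf I, ENNReal.ofReal (u ^ 2) < cvm w (fun p => z p) ↔
      u < cvmRoot w (fun _ => 0) z := fun z => by
    rw [cvm_coe_eq hw hs]
    rw [ENNReal.ofReal_lt_ofReal_iff_of_nonneg (by positivity),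
      pow_lt_pow_iff_left₀ hu (cvmRoot_nonneg z) two_ne_zero]
  have m1 : MeasurableSet {x : I → ℝ | cvm w x < ENNReal.ofReal (q ^ 2)} :=
    measurableSet_lt measurable_cvm measurable_const
  have m2 : MeasurableSet {x : I → ℝ | ENNReal.ofReal (u ^ 2) < cvm w x ∧
      cvm w x < ENNReal.ofReal (q ^ 2)} :=
    (measurableSet_lt measurable_const measurable_cvm).inter m1
  have msq : Measurable fun x : I → ℝ => ∑' p, ENNReal.ofReal (x p ^ 2 * w p) :=
    Measurable.tsum fun p =>
      (((measurable_pi_apply p).pow_const 2).mul_const _).ennreal_ofReal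
  have m3 : MeasurableSet {x : I → ℝ | ∑' p, ENNReal.ofReal (x p ^ 2 * w p) = ∞} :=
    measurableSet_eq_fun msq measurable_const
  have fin : ∀ z : Linf I, ∑' p, ENNReal.ofReal (z p ^ 2 * w p) ≠ ∞ := fun z => by
    have S : Summable fun p => z p ^ 2 * w p := by
      refine Summable.of_nonneg_of_le (fun p => ?_) (fun p => ?_) (hs.mul_left (‖z‖ ^ 2))
      · have := hw p
        positivity
      · refine mul_le_mul_of_nonneg_right ?_ (hw p)
        rw [← sq_abs]
        exact pow_le_pow_left₀ (abs_nonneg _) (abs_coord_le z p) 2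
    exact S.tsum_ofReal_ne_top
  -- Transfers summability of the squares, valid at every bounded path, to almost every point of
  -- almost every line.
  have n3 := (hΓ.null_iff_line hp m3).1 (by
    have : {z : Linf I | (fun p => z p) ∈ {x : I → ℝ | ∑' p, ENNReal.ofReal (x p ^ 2 * w p) = ∞}}
        = ∅ := by
      ext z
      simpa using fin z
    rw [this, measure_empty])
  have n2 := (hΓ.null_iff_line hp m2).1 (by
    simp only [mem_ofPred_eq, iff1, iff2]
    exact h0)
  have n1 := (hΓ.null_iff_line hp m1).2 ?_
  · simpa only [mem_ofPred_eq, iff1] using n1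
  filter_upwards [n2, n3] with y hy2 hy3
  set a : I → ℝ := fun p => κ p p₀ / κ p₀ p₀
  have ha : 0 < a p₀ := by positivity
  -- A Gaussian-null set is Lebesgue-null, so it cannot contain a nonempty open set.
  have hvol : (volume : Measure ℝ) ≪ g := gaussianReal_absolutelyContinuous' 0 hv
  have hyfin : ∀ᵐ s : ℝ, Summable fun p => (y p + s * a p) ^ 2 * w p := by
    have h4 : ∀ᵐ s : ℝ, ¬ (∑' p, ENNReal.ofReal ((y p + s * a p) ^ 2 * w p) = ∞) := by
      rw [ae_iff]
      simp only [not_not]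
      exact hvol hy3
    filter_upwards [h4] with s hs4
    refine (ENNReal.summable_toReal hs4).congr fun p => ?_
    rw [ENNReal.toReal_ofReal]
    have := hw p
    positivity
  have hline : ∀ s : ℝ, Summable fun p => (max (y p + s * a p) 0) ^ 2 * w p := by
    have f1 : ∃ᵐ s : ℝ, Summable fun p => (y p + s * a p) ^ 2 * w p := hyfin.frequently
    obtain ⟨s1, h1⟩ := f1.exists
    obtain ⟨s2, h2, h12⟩ := (hyfin.and (Measure.ae_ne volume s1)).exists
    exact summable_line hw y a h12.symm h1 h2
  have hcont := continuous_cvmReal_line hw y a hline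
  have htop := tendsto_cvmReal_line hw hwp y a ha hline
  set f : ℝ → ℝ := fun s => cvmReal w fun p => y p + s * a p
  have hcvm : ∀ s : ℝ, cvm w (fun p => y p + s * a p) = ENNReal.ofReal (f s) := fun s =>
    cvm_eq_ofReal hw (hline s)
  have hempty : {s : ℝ | (fun p => y p + s * a p) ∈ {x | cvm w x < ENNReal.ofReal (q ^ 2)}} = ∅ := by
    by_contra hne
    obtain ⟨s0, hs0⟩ := nonempty_iff_ne_empty.2 hne
    simp only [mem_ofPred_eq, hcvm] at hs0 hy2
    rw [ENNReal.ofReal_lt_ofReal_iff (by positivity)] at hs0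
    have hopen : IsOpen {s : ℝ | u ^ 2 < f s ∧ f s < q ^ 2} :=
      (isOpen_lt continuous_const hcont).inter (isOpen_lt hcont continuous_const)
    have huq2 : u ^ 2 < q ^ 2 := pow_lt_pow_left₀ huq hu two_ne_zero
    -- A value inside the window and above `f s0`, so that it is attained to the right of `s0` by
    -- the intermediate value theorem.
    obtain ⟨m, hm1, hm2⟩ := exists_between (max_lt huq2 hs0)
    have hmem : m ∈ f '' univ := by
      obtain ⟨s1, hs1, hs1m⟩ := ((eventually_ge_atTop s0).and (htop.eventually_ge_atTop m)).exists
      obtain ⟨s, -, hs⟩ := intermediate_value_Icc hs1 hcont.continuousOn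
        ⟨((le_max_right _ _).trans_lt hm1).le, hs1m⟩
      exact ⟨s, mem_univ _, hs⟩
    obtain ⟨s, -, hs⟩ := hmem
    have hnon : {s : ℝ | u ^ 2 < f s ∧ f s < q ^ 2}.Nonempty :=
      ⟨s, by rw [hs]; exact (le_max_left _ _).trans_lt hm1, by rw [hs]; exact hm2⟩
    have hpos := hopen.measure_pos volume hnon
    refine hpos.ne' (hvol ?_)
    refine measure_mono_null (fun s hs => ?_) hy2
    change _ ∧ _
    rw [hcvm]
    exact ⟨(ENNReal.ofReal_lt_ofReal_iff_of_nonneg (by positivity)).2 hs.1,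
      (ENNReal.ofReal_lt_ofReal_iff (by positivity)).2 hs.2⟩
  change g {s : ℝ | (fun p => y p + s * a p) ∈ {x | cvm w x < ENNReal.ofReal (q ^ 2)}} = 0
  rw [hempty, measure_empty]

end Gaussian

/-! ### Strict crossing of a level at the quantile. -/

section Quantile

/-- The quantile of a limit statistic at a level above one half: it is positive, and the
distribution function crosses the level strictly there. -/
lemma IsGaussianLaw.exists_quantile {I : Type} [Countable I] {Γ : Measure (Linf I)}
    {κ : I → I → ℝ} {w : I → ℝ} (hΓ : IsGaussianLaw Γ κ)
    (hw : ∀ p, 0 ≤ w p) (hs : Summable w) {p₀ : I} (hwp : 0 < w p₀) (hp : 0 < κ p₀ p₀)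
    {β : ℝ} (hβ : 1 / 2 < β) (hβ1 : β < 1) :
    ∃ q : ℝ, 0 < q ∧ (∀ u, 0 ≤ u → u < q → Γ.real {z | cvmRoot w (fun _ => 0) z ≤ u} < β) ∧
      ∀ u, q < u → β < Γ.real {z | cvmRoot w (fun _ => 0) z ≤ u} := by
  have := hΓ.isProbabilityMeasure
  set U : Linf I → ℝ := cvmRoot w (fun _ => 0)
  have hU : Measurable U := measurable_cvmRoot hw hs fun _ => le_rfl
  have hprob : IsProbabilityMeasure (Γ.map U) := Measure.isProbabilityMeasure_map hU.aemeasurable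
  set H := cdf (Γ.map U)
  have hH : ∀ u, H u = Γ.real {z | U z ≤ u} := fun u => by
    rw [cdf_eq_real, map_measureReal_apply hU measurableSet_Iic]
    rfl
  simp only [← hH]
  have hmono : Monotone H := monotone_cdf _
  obtain ⟨b, hb⟩ := ((tendsto_cdf_atTop (Γ.map U)).eventually (lt_mem_nhds hβ1)).exists
  set S := {u | H u ≤ β}
  have hbdd : BddAbove S := ⟨b, fun u hu => by
    by_contra hlt
    exact absurd (hmono (not_le.1 hlt).le) (not_le.2 (lt_of_le_of_lt hu hb))⟩
  have h0 : H 0 ≤ 1 / 2 := by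
    rw [hH]
    exact hΓ.cvmRoot_nonpos_le_half hw hs hwp hp
  have hrc : ∀ x, Tendsto H (𝓝[>] x) (𝓝 (H x)) := fun x =>
    (H.right_continuous x).mono_left (nhdsWithin_mono _ Ioi_subset_Ici_self)
  -- Right continuity at `0`, where the distribution function is at most one half, makes the
  -- quantile positive.
  obtain ⟨u0, hu0, hu0pos⟩ := (((hrc 0).eventually (gt_mem_nhds (h0.trans_lt hβ))).and
    self_mem_nhdsWithin).exists
  have hq0 : 0 < sSup S := lt_of_lt_of_le hu0pos (le_csSup hbdd hu0.le)
  have hgt : ∀ u, sSup S < u → β < H u := fun u hu => by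
    by_contra hle
    exact absurd (le_csSup hbdd (not_lt.1 hle)) (not_le.2 hu)
  refine ⟨sSup S, hq0, fun u hu huq => ?_, hgt⟩
  set q := sSup S
  have hqle : β ≤ H q := ge_of_tendsto (hrc q) (by
    filter_upwards [self_mem_nhdsWithin] with x hx using (hgt x hx).le)
  have hnull := hΓ.cvmRoot_level_null hw hs hq0
  have e1 : Γ.real {z | U z < q} = H q := by
    rw [hH]
    refine measureReal_congr ?_
    have : ∀ᵐ z ∂Γ, ¬ U z = q := by
      rw [ae_iff]
      simpa only [not_not] using hnull
    filter_upwards [this] with z hz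
    exact propext ⟨fun h => le_of_lt h, fun h => lt_of_le_of_ne h hz⟩
  have hne : Γ {z | U z < q} ≠ 0 := by
    intro h
    rw [measureReal_def, h, ENNReal.toReal_zero] at e1
    linarith
  have hwin := hΓ.cvmRoot_window_ne_zero hw hs hwp hp hu huq hne
  -- Strictness to the left of `q`: the mass below `q` is at most `β`, and part of it sits in the
  -- window between `u` and `q`.
  have hsup : Γ.real {z | U z < q} ≤ β := by
    have hm : ∀ x < q, H x ≤ β := fun x hx => by
      obtain ⟨y, hyS, hy⟩ := exists_lt_of_lt_csSup ⟨u0, hu0.le⟩ hx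
      exact (hmono hy.le).trans hyS
    obtain ⟨x, hx, hxq, hxt⟩ := exists_seq_strictMono_tendsto q
    have hun : {z | U z < q} = ⋃ n, {z | U z ≤ x n} := by
      ext z
      simp only [mem_ofPred_eq, mem_iUnion]
      refine ⟨fun hz => ?_, fun ⟨n, hn⟩ => hn.trans_lt (hxq n)⟩
      obtain ⟨n, hn⟩ := (hxt.eventually (lt_mem_nhds hz)).exists
      exact ⟨n, hn.le⟩
    have ht : Tendsto (fun n => Γ {z | U z ≤ x n}) atTop (𝓝 (Γ {z | U z < q})) := by
      rw [hun]
      exact tendsto_measure_iUnion_atTop fun m n hmn z hz => le_trans hz (hx.monotone hmn)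
    have ht' := (ENNReal.tendsto_toReal (measure_ne_top Γ _)).comp ht
    refine le_of_tendsto ht' (Eventually.of_forall fun n => ?_)
    have := hm _ (hxq n)
    rwa [hH] at this
  have hadd : Γ.real {z | U z ≤ u} + Γ.real {z | u < U z ∧ U z < q} ≤ Γ.real {z | U z < q} := by
    rw [← measureReal_union]
    · exact measureReal_mono fun z hz => hz.elim (fun h => lt_of_le_of_lt h huq) fun h => h.2
    · exact Set.disjoint_left.2 fun z hz hz' => absurd hz'.1 (not_lt.2 hz)
    · exact (measurableSet_lt measurable_const hU).inter (measurableSet_lt hU measurable_const)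
  have hpos : 0 < Γ.real {z | u < U z ∧ U z < q} :=
    ENNReal.toReal_pos hwin (measure_ne_top _ _)
  rw [hH]
  linarith

end Quantile

/-! ### Lipschitz approximations of indicators. -/

section Ramp

/-- The piecewise linear function that is `0` below `a` and `1` above `b`. -/
noncomputable def ramp (a b x : ℝ) : ℝ := max 0 (min 1 ((x - a) / (b - a)))

variable {a b x : ℝ}

lemma ramp_nonneg : 0 ≤ ramp a b x := le_max_left _ _

lemma ramp_le_one : ramp a b x ≤ 1 := max_le zero_le_one (min_le_left _ _)

lemma ramp_eq_zero (h : a < b) (hx : x ≤ a) : ramp a b x = 0 := by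
  refine max_eq_left ((min_le_right _ _).trans ?_)
  exact div_nonpos_of_nonpos_of_nonneg (by linarith) (by linarith)

lemma ramp_eq_one (h : a < b) (hx : b ≤ x) : ramp a b x = 1 := by
  have : 1 ≤ (x - a) / (b - a) := by
    rw [le_div_iff₀ (by linarith)]
    linarith
  rw [ramp, min_eq_left this, max_eq_right zero_le_one]

lemma lipschitzWith_ramp (h : a < b) : LipschitzWith (Real.toNNReal (b - a)⁻¹) (ramp a b) := by
  have h1 : LipschitzWith (Real.toNNReal (b - a)⁻¹) fun x : ℝ => (x - a) / (b - a) := by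
    have hpos : 0 < (b - a)⁻¹ := inv_pos.2 (by linarith)
    refine LipschitzWith.of_dist_le_mul fun x y => ?_
    rw [Real.coe_toNNReal _ hpos.le, Real.dist_eq, Real.dist_eq, ← sub_div, div_eq_inv_mul,
      abs_mul, abs_of_pos hpos]
    simp
  exact (h1.const_min 1).const_max 0

end Ramp

/-! ### Events of high probability and outer expectations. -/

section Outer

variable {Ω : Type*} [MeasurableSpace Ω] {Pr : Measure Ω}

variable (Pr) in
/-- The events `A L` have inner probability tending to one. -/
def WithHighProb (A : ℕ → Ω → Prop) : Prop :=
  Tendsto (fun L => Pr {ω | ¬ A L ω}) atTop (𝓝 0)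

lemma WithHighProb.mono {A A' : ℕ → Ω → Prop} (h : WithHighProb Pr A)
    (hAA : ∀ᶠ L in atTop, ∀ ω, A L ω → A' L ω) : WithHighProb Pr A' := by
  refine tendsto_of_tendsto_of_tendsto_of_le_of_le' tendsto_const_nhds h
    (Eventually.of_forall fun _ => zero_le) ?_
  filter_upwards [hAA] with L hL
  exact measure_mono fun ω hω hA => hω (hL ω hA)

lemma WithHighProb.and {A A' : ℕ → Ω → Prop} (h : WithHighProb Pr A) (h' : WithHighProb Pr A') :
    WithHighProb Pr fun L ω => A L ω ∧ A' L ω := by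
  have := h.add h'
  rw [add_zero] at this
  refine tendsto_of_tendsto_of_tendsto_of_le_of_le tendsto_const_nhds this
    (fun _ => zero_le) fun L => ?_
  refine (measure_mono fun ω hω => ?_).trans (measure_union_le _ _)
  by_cases hA : A L ω
  · exact Or.inr fun hA' => hω ⟨hA, hA'⟩
  · exact Or.inl hA

lemma WithHighProb.eventually_real_le {A : ℕ → Ω → Prop} (h : WithHighProb Pr A) {e : ℝ}
    (he : 0 < e) : ∀ᶠ L in atTop, Pr.real {ω | ¬ A L ω} ≤ e := by
  have := h.eventually (Iic_mem_nhds (ENNReal.ofReal_pos.2 he))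
  filter_upwards [this] with L hL
  exact ENNReal.toReal_le_of_le_ofReal he.le hL

variable [IsProbabilityMeasure Pr]

/-- Markov's inequality for every measurable majorant of `g`. The set `A` need not be measurable;
its measure is an outer measure. -/
lemma measure_le_outerExp {g : Ω → ℝ} {A : Set Ω} (h0 : ∀ ω, 0 ≤ g ω) (h1 : ∀ ω, g ω ≤ 1)
    (hA : ∀ ω ∈ A, 1 ≤ g ω) : Pr.real A ≤ outerExp Pr g := by
  refine le_csInf ⟨1, fun _ => 1, measurable_const, integrable_const _, h1, by simp⟩ ?_
  rintro r ⟨u, hu, hui, hgu, rfl⟩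
  have hm : MeasurableSet {ω | 1 ≤ u ω} := measurableSet_le measurable_const hu
  calc Pr.real A ≤ Pr.real {ω | 1 ≤ u ω} :=
        measureReal_mono fun ω hω => (hA ω hω).trans (hgu ω)
    _ = ∫ ω, {ω | 1 ≤ u ω}.indicator (fun _ => (1 : ℝ)) ω ∂Pr := by
        rw [integral_indicator_const _ hm, smul_eq_mul, mul_one]
    _ ≤ ∫ ω, u ω ∂Pr := by
        refine integral_mono ((integrable_const _).indicator hm) hui fun ω => ?_
        by_cases hω : ω ∈ {ω | 1 ≤ u ω}
        · rw [indicator_of_mem hω]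
          exact hω
        · rw [indicator_of_notMem hω]
          exact (h0 ω).trans (hgu ω)

/-- The indicator of a measurable hull of `A` is an admissible majorant. -/
lemma outerExp_le_measure {g : Ω → ℝ} {A : Set Ω} (h0 : ∀ ω, 0 ≤ g ω) (h1 : ∀ ω, g ω ≤ 1)
    (hA : ∀ ω, ω ∉ A → g ω ≤ 0) : outerExp Pr g ≤ Pr.real A := by
  have hm := measurableSet_toMeasurable Pr A
  refine csInf_le ⟨0, ?_⟩ ⟨(toMeasurable Pr A).indicator fun _ => 1,
    measurable_const.indicator hm, (integrable_const _).indicator hm, fun ω => ?_, ?_⟩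
  · rintro r ⟨u, hu, hui, hgu, rfl⟩
    exact integral_nonneg fun ω => (h0 ω).trans (hgu ω)
  · by_cases hω : ω ∈ toMeasurable Pr A
    · rw [indicator_of_mem hω]
      exact h1 ω
    · rw [indicator_of_notMem hω]
      exact hA ω fun h => hω (subset_toMeasurable Pr A h)
  · rw [integral_indicator_const _ hm, smul_eq_mul, mul_one, measureReal_def, measureReal_def,
      measure_toMeasurable]

lemma withHighProb_of_real {A : ℕ → Ω → Prop}
    (h : ∀ e > 0, ∀ᶠ L in atTop, Pr.real {ω | ¬ A L ω} ≤ e) : WithHighProb Pr A := by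
  refine ENNReal.tendsto_nhds_zero.2 fun e he => ?_
  rcases eq_or_ne e ∞ with rfl | hne
  · simp
  filter_upwards [h e.toReal (ENNReal.toReal_pos he.ne' hne)] with L hL
  exact (ENNReal.toReal_le_toReal (measure_ne_top _ _) hne).1 hL

end Outer

/-! ### Portmanteau inequalities for weak convergence in `ℓ^∞`. -/

section Portmanteau

variable {Ω : Type*} [MeasurableSpace Ω] {Pr : Measure Ω} {I : Type} {Γ : Measure (Linf I)}

lemma WeakConv.tendsto_ramp {Z : ℕ → Ω → I → ℝ} (h : WeakConv Pr Z Γ) {U : Linf I → ℝ}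
    (hU : Continuous U) {a b : ℝ} (hab : a < b) :
    Tendsto (fun L => outerExp Pr fun ω => ramp a b (U (toLinf (Z L ω)))) atTop
      (𝓝 (∫ z, ramp a b (U z) ∂Γ)) :=
  h.tendsto (fun z => ramp a b (U z)) ((lipschitzWith_ramp hab).continuous.comp hU)
    ⟨1, fun z => abs_le.2 ⟨by linarith [@ramp_nonneg a b (U z)], ramp_le_one⟩⟩

variable [IsProbabilityMeasure Pr] [IsProbabilityMeasure Γ]

lemma integral_ramp_le {U : Linf I → ℝ} (hU : Continuous U) {a b : ℝ} (hab : a < b) :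
    ∫ z, ramp a b (U z) ∂Γ ≤ Γ.real {z | a < U z} := by
  have hm : MeasurableSet {z | a < U z} := measurableSet_lt measurable_const hU.measurable
  rw [← mul_one (Γ.real _), ← smul_eq_mul, ← integral_indicator_const _ hm]
  refine integral_mono_of_nonneg (Eventually.of_forall fun _ => ramp_nonneg)
    ((integrable_const _).indicator hm) (Eventually.of_forall fun z => ?_)
  by_cases hz : z ∈ {z | a < U z}
  · simp only [indicator_of_mem hz]
    exact ramp_le_one
  · simp only [indicator_of_notMem hz]
    exact (ramp_eq_zero hab (not_lt.1 hz)).le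

lemma le_integral_ramp {U : Linf I → ℝ} (hU : Continuous U) {a b : ℝ} (hab : a < b) :
    Γ.real {z | b ≤ U z} ≤ ∫ z, ramp a b (U z) ∂Γ := by
  have hm : MeasurableSet {z | b ≤ U z} := measurableSet_le measurable_const hU.measurable
  have hr : Continuous fun z => ramp a b (U z) := (lipschitzWith_ramp hab).continuous.comp hU
  rw [← mul_one (Γ.real _), ← smul_eq_mul, ← integral_indicator_const _ hm]
  refine integral_mono_of_nonneg (Eventually.of_forall fun z => ?_) ?_
    (Eventually.of_forall fun z => ?_)
  · exact indicator_nonneg (fun _ _ => zero_le_one) z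
  · refine Integrable.of_bound (C := 1) hr.measurable.aestronglyMeasurable
      (Eventually.of_forall fun z => ?_)
    rw [Real.norm_eq_abs, abs_of_nonneg ramp_nonneg]
    exact ramp_le_one
  · by_cases hz : z ∈ {z | b ≤ U z}
    · simp only [indicator_of_mem hz]
      exact (ramp_eq_one hab hz).ge
    · simp only [indicator_of_notMem hz]
      exact ramp_nonneg

/-- The gap `a < b` leaves room for a ramp, so no continuity of the limit distribution is needed
here. -/
lemma WeakConv.eventually_le {Z : ℕ → Ω → I → ℝ} (h : WeakConv Pr Z Γ) {U : Linf I → ℝ}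
    (hU : Continuous U) {a b e : ℝ} (hab : a < b) (he : 0 < e) :
    ∀ᶠ L in atTop, Pr.real {ω | b ≤ U (toLinf (Z L ω))} ≤ Γ.real {z | a < U z} + e := by
  filter_upwards [(h.tendsto_ramp hU hab).eventually (gt_mem_nhds (lt_add_of_pos_right _ he))]
    with L hL
  have h1 := measure_le_outerExp (Pr := Pr) (g := fun ω => ramp a b (U (toLinf (Z L ω))))
    (A := {ω | b ≤ U (toLinf (Z L ω))}) (fun _ => ramp_nonneg) (fun _ => ramp_le_one)
    fun ω hω => (ramp_eq_one hab hω).ge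
  have h2 := integral_ramp_le (Γ := Γ) hU hab
  linarith

lemma WeakConv.eventually_ge {Z : ℕ → Ω → I → ℝ} (h : WeakConv Pr Z Γ) {U : Linf I → ℝ}
    (hU : Continuous U) {a b e : ℝ} (hab : a < b) (he : 0 < e) :
    ∀ᶠ L in atTop, Γ.real {z | b ≤ U z} - e ≤ Pr.real {ω | a < U (toLinf (Z L ω))} := by
  filter_upwards [(h.tendsto_ramp hU hab).eventually (lt_mem_nhds (sub_lt_self _ he))]
    with L hL
  have h1 := outerExp_le_measure (Pr := Pr) (g := fun ω => ramp a b (U (toLinf (Z L ω))))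
    (A := {ω | a < U (toLinf (Z L ω))}) (fun _ => ramp_nonneg) (fun _ => ramp_le_one)
    fun ω hω => (ramp_eq_zero hab (not_lt.1 hω)).le
  have h2 := le_integral_ramp (Γ := Γ) hU hab
  linarith

lemma tendsto_measureReal_gt_atTop {X : Type*} [MeasurableSpace X] {μ : Measure X}
    [IsFiniteMeasure μ] {U : X → ℝ} (hU : Measurable U) :
    Tendsto (fun n : ℕ => μ.real {z | (n : ℝ) < U z}) atTop (𝓝 0) := by
  have hm : ∀ n : ℕ, MeasurableSet {z | (n : ℝ) < U z} := fun n =>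
    measurableSet_lt measurable_const hU
  have h := tendsto_measure_iInter_atTop (μ := μ) (s := fun n : ℕ => {z | (n : ℝ) < U z})
    (fun n => (hm n).nullMeasurableSet)
    (fun m n hmn z (hz : (n : ℝ) < U z) => (Nat.cast_le.2 hmn).trans_lt hz) ⟨0, measure_ne_top _ _⟩
  have he : ⋂ n : ℕ, {z | (n : ℝ) < U z} = ∅ := by
    ext z
    simp only [mem_iInter, mem_ofPred_eq, mem_empty_iff_false, iff_false, not_forall, not_lt]
    exact exists_nat_ge (U z)
  rw [he, measure_empty] at h
  have := (ENNReal.tendsto_toReal ENNReal.zero_ne_top).comp h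
  exact this

/-- A weakly convergent sequence is asymptotically bounded by any sequence tending to infinity. -/
lemma WeakConv.withHighProb_norm_le {Z : ℕ → Ω → I → ℝ} (h : WeakConv Pr Z Γ) {r : ℕ → ℝ}
    (hr : Tendsto r atTop atTop) : WithHighProb Pr fun L ω => ‖toLinf (Z L ω)‖ ≤ r L := by
  refine withHighProb_of_real fun e he => ?_
  obtain ⟨n, hn⟩ := ((tendsto_measureReal_gt_atTop (μ := Γ) (measurable_norm)).eventually
    (gt_mem_nhds (half_pos he))).exists
  filter_upwards [h.eventually_le (U := fun z => ‖z‖) continuous_norm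
    (show (n : ℝ) < n + 1 by linarith) (half_pos he), hr.eventually_ge_atTop ((n : ℝ) + 1)]
    with L hL hrL
  calc Pr.real {ω | ¬ ‖toLinf (Z L ω)‖ ≤ r L}
      ≤ Pr.real {ω | (n : ℝ) + 1 ≤ ‖toLinf (Z L ω)‖} :=
        measureReal_mono fun ω hω => hrL.trans (not_le.1 hω).le
    _ ≤ Γ.real {z | (n : ℝ) < ‖z‖} + e / 2 := hL
    _ ≤ e := by linarith

lemma coe_toLinf {z : I → ℝ} (hz : Memℓp z ∞) (p : I) : (toLinf z) p = z p := by
  simp [toLinf, hz]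

end Portmanteau

/-! ### Bootstrap probabilities and conditional weak convergence. -/

section Bootstrap

lemma bootExp_mono {L : ℕ} {g g' : (Fin L → Fin L) → ℝ} (h : ∀ ι, g ι ≤ g' ι) :
    bootExp g ≤ bootExp g' :=
  div_le_div_of_nonneg_right (Finset.sum_le_sum fun ι _ => h ι) (by positivity)

lemma bootExp_const_mul {L : ℕ} (c : ℝ) (g : (Fin L → Fin L) → ℝ) :
    bootExp (fun ι => c * g ι) = c * bootExp g := by
  simp only [bootExp, ← Finset.mul_sum, mul_div_assoc]

lemma bootProb_mono {L : ℕ} {A A' : (Fin L → Fin L) → Prop} (h : ∀ ι, A ι → A' ι) :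
    bootProb A ≤ bootProb A' := by
  classical
  refine bootExp_mono fun ι => ?_
  by_cases hA : A ι
  · simp [hA, h ι hA]
  · simp only [hA, if_false]
    split_ifs <;> norm_num

lemma bootProb_false {L : ℕ} {A : (Fin L → Fin L) → Prop} (h : ∀ ι, ¬ A ι) : bootProb A = 0 := by
  simp [bootProb, bootExp, h]

lemma bootProb_le_bootExp {L : ℕ} {A : (Fin L → Fin L) → Prop} {g : (Fin L → Fin L) → ℝ}
    (h0 : ∀ ι, 0 ≤ g ι) (h : ∀ ι, A ι → 1 ≤ g ι) : bootProb A ≤ bootExp g := by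
  classical
  refine bootExp_mono fun ι => ?_
  by_cases hA : A ι
  · simpa [hA] using h ι hA
  · simpa [hA] using h0 ι

lemma bootExp_le_bootProb {L : ℕ} {A : (Fin L → Fin L) → Prop} {g : (Fin L → Fin L) → ℝ}
    (h1 : ∀ ι, g ι ≤ 1) (h : ∀ ι, ¬ A ι → g ι ≤ 0) : bootExp g ≤ bootProb A := by
  classical
  refine bootExp_mono fun ι => ?_
  by_cases hA : A ι
  · simpa [hA] using h1 ι
  · simpa [hA] using h ι hA

lemma bootProb_not {L : ℕ} (A : (Fin L → Fin L) → Prop) :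
    bootProb (fun ι => ¬ A ι) = 1 - bootProb A := by
  classical
  -- For `L = 0` the normalization is `0 ^ 0 = 1`, matching the single self-map of the empty type.
  have hc : ((L : ℝ) ^ L) ≠ 0 := by
    rcases Nat.eq_zero_or_pos L with rfl | h
    · simp
    · positivity
  unfold bootProb bootExp
  rw [eq_sub_iff_add_eq, ← add_div, ← Finset.sum_add_distrib, div_eq_one_iff_eq hc]
  refine (Finset.sum_congr rfl fun ι _ => (?_ : _ = (1 : ℝ))).trans (by simp)
  by_cases hA : A ι <;> simp [hA]

variable {Ω : Type*} [MeasurableSpace Ω] {Pr : Measure Ω} {I : Type} {Γ : Measure (Linf I)}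

/-- A ramp of a Lipschitz functional becomes a test function of the bounded-Lipschitz metric after
scaling by `(1 + K')⁻¹`; this is where the Lipschitz constant of the root functional is used. -/
lemma BootWeakConv.withHighProb_ramp {Zs : (L : ℕ) → Ω → (Fin L → Fin L) → I → ℝ}
    (h : BootWeakConv Pr Zs Γ) {U : Linf I → ℝ} {K : NNReal} (hU : LipschitzWith K U)
    {a b e : ℝ} (hab : a < b) (he : 0 < e) :
    WithHighProb Pr fun L ω => |bootExp (fun ι => ramp a b (U (toLinf (Zs L ω ι))))
      - ∫ z, ramp a b (U z) ∂Γ| ≤ e := by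
  set K' : NNReal := Real.toNNReal (b - a)⁻¹ * K
  have hL : LipschitzWith K' fun z => ramp a b (U z) := (lipschitzWith_ramp hab).comp hU
  set k : ℝ := (1 + K')⁻¹
  have hK' : (0 : ℝ) ≤ K' := K'.2
  have hk : 0 < k := by positivity
  have hk1 : k ≤ 1 := inv_le_one_of_one_le₀ (by linarith)
  have hkK : k * K' ≤ 1 := by
    rw [inv_mul_le_iff₀ (by positivity)]
    linarith
  have hBL : IsBL1 fun z => k * ramp a b (U z) := by
    refine ⟨fun z => ?_, LipschitzWith.of_dist_le_mul fun z z' => ?_⟩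
    · rw [abs_of_nonneg (mul_nonneg hk.le ramp_nonneg)]
      exact mul_le_one₀ hk1 ramp_nonneg ramp_le_one
    · rw [Real.dist_eq, ← mul_sub, abs_mul, abs_of_pos hk, ← Real.dist_eq, NNReal.coe_one, one_mul]
      calc k * dist (ramp a b (U z)) (ramp a b (U z')) ≤ k * (K' * dist z z') := by
            gcongr
            exact hL.dist_le_mul z z'
        _ = (k * K') * dist z z' := by ring
        _ ≤ 1 * dist z z' := by gcongr
        _ = dist z z' := one_mul _
  refine tendsto_of_tendsto_of_tendsto_of_le_of_le tendsto_const_nhds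
    (h.tendsto (k * e) (by positivity)) (fun _ => zero_le) fun L => measure_mono fun ω hω => ?_
  refine ⟨_, hBL, ?_⟩
  rw [bootExp_const_mul, integral_const_mul, ← mul_sub, abs_mul, abs_of_pos hk]
  exact mul_lt_mul_of_pos_left (not_le.1 hω) hk

variable [IsProbabilityMeasure Γ]

lemma BootWeakConv.withHighProb_le {Zs : (L : ℕ) → Ω → (Fin L → Fin L) → I → ℝ}
    (h : BootWeakConv Pr Zs Γ) {U : Linf I → ℝ} {K : NNReal} (hU : LipschitzWith K U)
    {a b e : ℝ} (hab : a < b) (he : 0 < e) :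
    WithHighProb Pr fun L ω =>
      bootProb (fun ι => b ≤ U (toLinf (Zs L ω ι))) ≤ Γ.real {z | a < U z} + e := by
  refine (h.withHighProb_ramp hU hab he).mono (Eventually.of_forall fun L ω hω => ?_)
  have h1 := bootProb_le_bootExp (A := fun ι => b ≤ U (toLinf (Zs L ω ι)))
    (g := fun ι => ramp a b (U (toLinf (Zs L ω ι)))) (fun _ => ramp_nonneg)
    fun ι hι => (ramp_eq_one hab hι).ge
  have h2 := integral_ramp_le (Γ := Γ) hU.continuous hab
  have h3 := (abs_le.1 hω).2
  linarith

lemma BootWeakConv.withHighProb_ge {Zs : (L : ℕ) → Ω → (Fin L → Fin L) → I → ℝ}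
    (h : BootWeakConv Pr Zs Γ) {U : Linf I → ℝ} {K : NNReal} (hU : LipschitzWith K U)
    {a b e : ℝ} (hab : a < b) (he : 0 < e) :
    WithHighProb Pr fun L ω =>
      Γ.real {z | b ≤ U z} - e ≤ bootProb (fun ι => a < U (toLinf (Zs L ω ι))) := by
  refine (h.withHighProb_ramp hU hab he).mono (Eventually.of_forall fun L ω hω => ?_)
  have h1 := bootExp_le_bootProb (A := fun ι => a < U (toLinf (Zs L ω ι)))
    (g := fun ι => ramp a b (U (toLinf (Zs L ω ι)))) (fun _ => ramp_le_one)
    fun ι hι => (ramp_eq_zero hab (not_lt.1 hι)).le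
  have h2 := le_integral_ramp (Γ := Γ) hU.continuous hab
  have h3 := (abs_le.1 hω).1
  linarith

/-- Bootstrap distribution functions are eventually above the limit at smaller arguments. -/
lemma BootWeakConv.withHighProb_cdf_ge {Zs : (L : ℕ) → Ω → (Fin L → Fin L) → I → ℝ}
    (h : BootWeakConv Pr Zs Γ) {U : Linf I → ℝ} {K : NNReal} (hU : LipschitzWith K U)
    {a b e : ℝ} (hab : a < b) (he : 0 < e) :
    WithHighProb Pr fun L ω =>
      Γ.real {z | U z ≤ a} - e ≤ bootProb (fun ι => U (toLinf (Zs L ω ι)) ≤ b) := by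
  refine (h.withHighProb_le hU hab he).mono (Eventually.of_forall fun L ω hω => ?_)
  have h1 : Γ.real {z | a < U z} = 1 - Γ.real {z | U z ≤ a} := by
    have : {z | a < U z} = {z | U z ≤ a}ᶜ := by
      ext z
      simp
    rw [this, measureReal_compl (measurableSet_le hU.continuous.measurable measurable_const)]
    simp
  have h2 := bootProb_not fun ι => b ≤ U (toLinf (Zs L ω ι))
  have h3 : bootProb (fun ι => ¬ b ≤ U (toLinf (Zs L ω ι)))
      ≤ bootProb (fun ι => U (toLinf (Zs L ω ι)) ≤ b) :=
    bootProb_mono fun ι hι => (not_le.1 hι).le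
  linarith

/-- Bootstrap distribution functions are eventually below the limit at larger arguments. -/
lemma BootWeakConv.withHighProb_cdf_le {Zs : (L : ℕ) → Ω → (Fin L → Fin L) → I → ℝ}
    (h : BootWeakConv Pr Zs Γ) {U : Linf I → ℝ} {K : NNReal} (hU : LipschitzWith K U)
    {a b e : ℝ} (hab : a < b) (he : 0 < e) :
    WithHighProb Pr fun L ω =>
      bootProb (fun ι => U (toLinf (Zs L ω ι)) ≤ a) ≤ Γ.real {z | U z ≤ b} + e := by
  refine (h.withHighProb_ge hU hab he).mono (Eventually.of_forall fun L ω hω => ?_)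
  have h1 : Γ.real {z | U z < b} = 1 - Γ.real {z | b ≤ U z} := by
    have : {z | U z < b} = {z | b ≤ U z}ᶜ := by
      ext z
      simp
    rw [this, measureReal_compl (measurableSet_le measurable_const hU.continuous.measurable)]
    simp
  have h2 := bootProb_not fun ι => a < U (toLinf (Zs L ω ι))
  have h3 : Γ.real {z | U z < b} ≤ Γ.real {z | U z ≤ b} := measureReal_mono fun z (hz : U z < b) => hz.le
  simp only [not_lt] at h2
  linarith

end Bootstrap

/-! ### Monotonicity of `ξ` and the signs of the moments. -/

section Cells

variable {bl bu : ℝ} {P T h : ℝ → ℝ}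

lemma RegularReducedForm.continuousOn_xi (hPT : RegularReducedForm bl bu P T) :
    ContinuousOn (xi P T) (Ioo bl bu) := by
  have hP := hPT.contDiff_P.continuousOn_deriv_of_isOpen isOpen_Ioo (by norm_num)
  have hT := hPT.contDiff_T.continuousOn_deriv_of_isOpen isOpen_Ioo (by norm_num)
  exact hT.div hP fun b hb => (hPT.deriv_pos b hb).ne'

lemma RegularReducedForm.exists_bound (hPT : RegularReducedForm bl bu P T) :
    ∃ C, ∀ b ∈ Ioo bl bu, |xi P T b| ≤ C := by
  obtain ⟨x, hx⟩ := hPT.left_limit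
  obtain ⟨y, hy⟩ := hPT.right_limit
  have hc := continuousOn_Icc_extendFrom_Ioo hPT.continuousOn_xi hx hy
  obtain ⟨C, hC⟩ := isCompact_Icc.exists_bound_of_continuousOn hc
  refine ⟨C, fun b hbm => ?_⟩
  have := hC b (Ioo_subset_Icc_self hbm)
  rwa [extendFrom_extends hPT.continuousOn_xi _ hbm] at this

lemma deriv_T_eq (hPT : RegularReducedForm bl bu P T) {x : ℝ} (hx : x ∈ Ioo bl bu) :
    h x * deriv T x = h x * deriv P x * xi P T x := by
  have := (hPT.deriv_pos x hx).ne'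
  rw [xi]
  field_simp

variable {c d : ℝ}

lemma ae_mem_Ioo (hc : bl ≤ c) (hd : d ≤ bu) (hcd : c ≤ d) :
    ∀ᵐ x ∂(volume.restrict (uIoc c d)), x ∈ Ioo bl bu := by
  rw [uIoc_of_le hcd, ← restrict_Ioo_eq_restrict_Ioc]
  filter_upwards [ae_restrict_mem measurableSet_Ioo] with x hx
  exact ⟨hc.trans_lt hx.1, hx.2.trans_le hd⟩

lemma IsWeight.intervalIntegrable (hh : IsWeight bl bu P h) (hc : bl ≤ c) (hd : d ≤ bu)
    (hcd : c ≤ d) : IntervalIntegrable (fun x => h x * deriv P x) volume c d := by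
  obtain ⟨K, hK⟩ := hh.bound
  refine (intervalIntegrable_const (c := K)).mono_fun
    (hh.measurable.mul (measurable_deriv P)).aestronglyMeasurable ?_
  filter_upwards [ae_mem_Ioo hc hd hcd] with x hx
  obtain ⟨h1, h2⟩ := hK x hx
  rw [Real.norm_eq_abs, Real.norm_eq_abs, abs_of_pos h1]
  exact h2.trans (le_abs_self _)

lemma intervalIntegrable_T (hPT : RegularReducedForm bl bu P T)
    (hh : IsWeight bl bu P h) (hc : bl ≤ c) (hd : d ≤ bu) (hcd : c ≤ d) :
    IntervalIntegrable (fun x => h x * deriv T x) volume c d := by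
  obtain ⟨C, hC⟩ := hPT.exists_bound
  refine ((hh.intervalIntegrable hc hd hcd).const_mul C).mono_fun
    (hh.measurable.mul (measurable_deriv T)).aestronglyMeasurable ?_
  filter_upwards [ae_mem_Ioo hc hd hcd] with x hx
  rw [deriv_T_eq hPT hx, norm_mul, norm_mul C, mul_comm]
  gcongr
  exact (hC x hx).trans (le_abs_self _)

lemma integral_weight_pos (hh : IsWeight bl bu P h) (hc : bl ≤ c) (hd : d ≤ bu) (hcd : c < d) :
    0 < ∫ x in c..d, h x * deriv P x := by
  obtain ⟨K, hK⟩ := hh.bound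
  exact intervalIntegral.intervalIntegral_pos_of_pos_on (hh.intervalIntegrable hc hd hcd.le)
    (fun x hx => (hK x ⟨hc.trans_lt hx.1, hx.2.trans_le hd⟩).1) hcd

lemma integral_T_le (hPT : RegularReducedForm bl bu P T)
    (hh : IsWeight bl bu P h) (hc : bl ≤ c) (hd : d ≤ bu) (hcd : c ≤ d) {m : ℝ}
    (hm : ∀ x ∈ Ioo c d, xi P T x ≤ m) :
    ∫ x in c..d, h x * deriv T x ≤ m * ∫ x in c..d, h x * deriv P x := by
  obtain ⟨K, hK⟩ := hh.bound
  rw [← intervalIntegral.integral_const_mul]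
  refine intervalIntegral.integral_mono_on_of_le_Ioo hcd (intervalIntegrable_T hPT hh hc hd hcd)
    ((hh.intervalIntegrable hc hd hcd).const_mul m) fun x hx => ?_
  have hx' : x ∈ Ioo bl bu := ⟨hc.trans_lt hx.1, hx.2.trans_le hd⟩
  rw [deriv_T_eq hPT hx', mul_comm m]
  exact mul_le_mul_of_nonneg_left (hm x hx) (hK x hx').1.le

lemma le_integral_T (hPT : RegularReducedForm bl bu P T)
    (hh : IsWeight bl bu P h) (hc : bl ≤ c) (hd : d ≤ bu) (hcd : c ≤ d) {m : ℝ}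
    (hm : ∀ x ∈ Ioo c d, m ≤ xi P T x) :
    m * ∫ x in c..d, h x * deriv P x ≤ ∫ x in c..d, h x * deriv T x := by
  obtain ⟨K, hK⟩ := hh.bound
  rw [← intervalIntegral.integral_const_mul]
  refine intervalIntegral.integral_mono_on_of_le_Ioo hcd
    ((hh.intervalIntegrable hc hd hcd).const_mul m) (intervalIntegrable_T hPT hh hc hd hcd)
    fun x hx => ?_
  have hx' : x ∈ Ioo bl bu := ⟨hc.trans_lt hx.1, hx.2.trans_le hd⟩
  rw [deriv_T_eq hPT hx', mul_comm m]
  exact mul_le_mul_of_nonneg_left (hm x hx) (hK x hx').1.le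

lemma cell_upper_le (hb : bl < bu) {q j : ℕ} (hj : j < q) :
    bl + (bu - bl) * j / q + (bu - bl) / q ≤ bu := by
  have hq : (0 : ℝ) < q := by exact_mod_cast (Nat.zero_le j).trans_lt hj
  have hjq : (j : ℝ) + 1 ≤ q := by exact_mod_cast hj
  have e : bl + (bu - bl) * j / q + (bu - bl) / q = bl + (bu - bl) * ((j + 1) / q) := by
    field_simp
    ring
  rw [e]
  have h1 : ((j : ℝ) + 1) / q ≤ 1 := by
    rw [div_le_one hq]
    exact hjq
  nlinarith

/-- If `ξ` is increasing then all moments `ν` are nonpositive. -/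
lemma nu_nonpos_of_monotoneOn (hb : bl < bu) (hPT : RegularReducedForm bl bu P T)
    (hh : IsWeight bl bu P h) (hmono : MonotoneOn (xi P T) (Ioo bl bu)) (p : Idx bl bu) :
    nu bl bu P T h p ≤ 0 := by
  obtain ⟨⟨b1, b2, q⟩, hq2, hlt, ⟨j1, hj1, e1⟩, ⟨j2, hj2, e2⟩⟩ := p
  simp only at hq2 hlt hj1 hj2 e1 e2
  have hq : (0 : ℝ) < q := by positivity
  have ha : 0 < (bu - bl) / q := div_pos (by linarith) hq
  have h2l : bl ≤ b2 := by
    rw [e2]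
    have : 0 ≤ (bu - bl) * j2 / q := div_nonneg (mul_nonneg (by linarith) (by positivity)) hq.le
    linarith
  have h1u : b1 + (bu - bl) / q ≤ bu := by
    rw [e1]
    exact cell_upper_le hb hj1
  have hj : j2 < j1 := by
    by_contra hle
    have : (j1 : ℝ) ≤ j2 := by exact_mod_cast not_lt.1 hle
    have h3 : (bu - bl) * j1 / q ≤ (bu - bl) * j2 / q := by
      have : 0 ≤ bu - bl := by linarith
      gcongr
    linarith
  have h21 : b2 + (bu - bl) / q ≤ b1 := by
    have : (j2 : ℝ) + 1 ≤ j1 := by exact_mod_cast hj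
    have h3 : (bu - bl) * ((j2 : ℝ) + 1) / q ≤ (bu - bl) * j1 / q := by
      have : 0 ≤ bu - bl := by linarith
      gcongr
    have h4 : (bu - bl) * ((j2 : ℝ) + 1) / q = (bu - bl) * j2 / q + (bu - bl) / q := by ring
    linarith
  have hb1 : b1 ∈ Ioo bl bu := ⟨by linarith, by linarith⟩
  -- Both cell averages are compared with `ξ b1`: the lower cell lies to the left of `b1`, the upper
  -- one to its right.
  have hM2 := integral_T_le hPT hh h2l (by linarith : b2 + (bu - bl) / q ≤ bu) (by linarith)
    (m := xi P T b1) fun x hx =>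
      hmono ⟨by linarith [hx.1], by linarith [hx.2]⟩ hb1 (by linarith [hx.2])
  have hM1 := le_integral_T hPT hh (by linarith : bl ≤ b1) h1u (by linarith)
    (m := xi P T b1) fun x hx => hmono hb1 ⟨by linarith [hx.1], by linarith [hx.2]⟩ hx.1.le
  have hW2 := integral_weight_pos hh h2l (by linarith : b2 + (bu - bl) / q ≤ bu) (by linarith)
  have hW1 := integral_weight_pos hh (by linarith : bl ≤ b1) h1u (by linarith)
  simp only [nu, nuOf, cellIntegral]
  nlinarith [mul_le_mul_of_nonneg_right hM2 hW1.le, mul_le_mul_of_nonneg_right hM1 hW2.le]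

lemma exists_cell (hb : bl < bu) {x : ℝ} (hx : x ∈ Ioo bl bu) {q : ℕ} (hq : 0 < q) :
    ∃ j : ℕ, j < q ∧ bl + (bu - bl) * j / q ≤ x ∧
      x < bl + (bu - bl) * j / q + (bu - bl) / q := by
  have ha : 0 < bu - bl := by linarith
  have hq' : (0 : ℝ) < q := by exact_mod_cast hq
  set y := (x - bl) * q / (bu - bl)
  have hy : 0 ≤ y := div_nonneg (mul_nonneg (by linarith [hx.1]) hq'.le) ha.le
  have hyx : x = bl + (bu - bl) * y / q := by
    simp only [y]
    field_simp
    ring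
  refine ⟨⌊y⌋₊, ?_, ?_, ?_⟩
  · rw [Nat.floor_lt hy]
    simp only [y]
    rw [div_lt_iff₀ ha]
    nlinarith [hx.2]
  · have := Nat.floor_le hy
    have h3 : (bu - bl) * ⌊y⌋₊ / q ≤ (bu - bl) * y / q := by gcongr
    linarith
  · have := Nat.lt_floor_add_one y
    have h3 : (bu - bl) * y / q < (bu - bl) * (⌊y⌋₊ + 1) / q := by gcongr
    have h4 : (bu - bl) * ((⌊y⌋₊ : ℝ) + 1) / q = (bu - bl) * ⌊y⌋₊ / q + (bu - bl) / q := by ring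
    linarith

/-- If `ξ` is not increasing then some moment `ν` is positive. -/
lemma exists_nu_pos (hb : bl < bu) (hPT : RegularReducedForm bl bu P T)
    (hh : IsWeight bl bu P h) (hmono : ¬ MonotoneOn (xi P T) (Ioo bl bu)) :
    ∃ p : Idx bl bu, 0 < nu bl bu P T h p := by
  simp only [MonotoneOn, not_forall, not_le] at hmono
  obtain ⟨x, hx, y, hy, hxy, hlt⟩ := hmono
  have hxy : x < y := lt_of_le_of_ne hxy fun h => by
    rw [h] at hlt
    exact lt_irrefl _ hlt
  obtain ⟨m, hm1, hm⟩ := exists_between hlt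
  obtain ⟨m', hmm', hm2⟩ := exists_between hm
  have hcx := hPT.continuousOn_xi.continuousAt (isOpen_Ioo.mem_nhds hx)
  have hcy := hPT.continuousOn_xi.continuousAt (isOpen_Ioo.mem_nhds hy)
  obtain ⟨d1, hd1, hx1⟩ := Metric.eventually_nhds_iff.1 (hcx.eventually (lt_mem_nhds hm2))
  obtain ⟨d2, hd2, hy2⟩ := Metric.eventually_nhds_iff.1 (hcy.eventually (gt_mem_nhds hm1))
  -- The cells become so narrow that `ξ > m'` on the cell of `x` and `ξ < m` on the cell of `y`, and
  -- that the two cells differ.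
  have hlim : Tendsto (fun q : ℕ => (bu - bl) / (q : ℝ)) atTop (𝓝 0) :=
    tendsto_const_div_atTop_nhds_zero_nat _
  obtain ⟨q, hq2, hq⟩ := ((eventually_ge_atTop 2).and (hlim.eventually (gt_mem_nhds
    (show 0 < min (min d1 d2) ((y - x) / 2) from
      lt_min (lt_min hd1 hd2) (by linarith))))).exists
  rw [lt_min_iff, lt_min_iff] at hq
  obtain ⟨⟨hqa, hqb⟩, hqc⟩ := hq
  have hq' : (0 : ℝ) < q := by positivity
  have ha : 0 < (bu - bl) / q := div_pos (by linarith) hq'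
  obtain ⟨j2, hj2, l2, u2⟩ := exists_cell hb hx (q := q) (by omega)
  obtain ⟨j1, hj1, l1, u1⟩ := exists_cell hb hy (q := q) (by omega)
  have low : ∀ j : ℕ, bl ≤ bl + (bu - bl) * j / q := fun j => by
    have : 0 ≤ (bu - bl) * j / q := div_nonneg (mul_nonneg (by linarith) (by positivity)) hq'.le
    linarith
  have up1 := cell_upper_le hb hj1
  have up2 := cell_upper_le hb hj2
  have low1 := low j1
  have low2 := low j2
  set b1 := bl + (bu - bl) * j1 / q with hb1
  set b2 := bl + (bu - bl) * j2 / q with hb2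
  refine ⟨⟨(b1, b2, q), hq2, by simp only; linarith, ⟨j1, hj1, hb1⟩, ⟨j2, hj2, hb2⟩⟩, ?_⟩
  have hM2 := le_integral_T hPT hh low2 up2 (by linarith) (m := m') fun s hs =>
    (hx1 (by rw [Real.dist_eq, abs_lt]; constructor <;> linarith [hs.1, hs.2])).le
  have hM1 := integral_T_le hPT hh low1 up1 (by linarith) (m := m) fun s hs =>
    (hy2 (by rw [Real.dist_eq, abs_lt]; constructor <;> linarith [hs.1, hs.2])).le
  have hW2 := integral_weight_pos hh low2 up2 (by linarith)
  have hW1 := integral_weight_pos hh low1 up1 (by linarith)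
  simp only [nu, nuOf, cellIntegral]
  nlinarith [mul_le_mul_of_nonneg_right hM2 hW1.le, mul_le_mul_of_nonneg_right hM1 hW2.le,
    mul_pos (sub_pos.2 hmm') (mul_pos hW1 hW2)]

end Cells

/-! ### Quantiles of the simulated statistic. -/

section CriticalValue

variable {L : ℕ} {F : (Fin L → Fin L) → ℝ≥0∞} {β η : ℝ}

/-- The upper `β`-quantile of a simulated statistic, raised by `η`. -/
noncomputable def upperQuantile (F : (Fin L → Fin L) → ℝ≥0∞) (β η : ℝ) : EReal :=
  sSup {c : EReal | ∃ r : ℝ, c = (r : EReal) ∧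
    bootProb (fun ι => ((F ι : ℝ≥0∞) : EReal) ≤ (r : EReal)) ≤ β} + (η : EReal)

lemma coe_ennreal_le_coe_real {x : ℝ≥0∞} {r : ℝ} (hr : 0 ≤ r) :
    (x : EReal) ≤ (r : EReal) ↔ x ≤ ENNReal.ofReal r := by
  rw [← EReal.coe_ennreal_le_coe_ennreal_iff, EReal.coe_ennreal_ofReal, max_eq_left hr]

lemma le_upperQuantile {r : ℝ} (hr : 0 ≤ r)
    (h : bootProb (fun ι => F ι ≤ ENNReal.ofReal r) ≤ β) :
    ((r + η : ℝ) : EReal) ≤ upperQuantile F β η := by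
  rw [EReal.coe_add]
  have hmem : (r : EReal) ≤ sSup {c : EReal | ∃ r : ℝ, c = (r : EReal) ∧
      bootProb (fun ι => ((F ι : ℝ≥0∞) : EReal) ≤ (r : EReal)) ≤ β} :=
    le_sSup ⟨r, rfl, by simpa only [coe_ennreal_le_coe_real hr] using h⟩
  exact add_le_add hmem le_rfl

lemma upperQuantile_le {r : ℝ} (hr : 0 ≤ r)
    (h : β < bootProb (fun ι => F ι ≤ ENNReal.ofReal r)) :
    upperQuantile F β η ≤ ((r + η : ℝ) : EReal) := by
  rw [EReal.coe_add]
  refine add_le_add (sSup_le ?_) le_rfl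
  rintro c ⟨r', rfl, hr'⟩
  rw [EReal.coe_le_coe_iff]
  by_contra hlt
  refine absurd (h.trans_le (bootProb_mono fun ι hι => ?_)) (not_lt.2 hr')
  exact ((coe_ennreal_le_coe_real hr).2 hι).trans (EReal.coe_le_coe_iff.2 (not_le.1 hlt).le)

/-- The statistic is nonnegative, so every negative real belongs to the set whose supremum is taken.
This bound covers the degenerate case. -/
lemma eta_le_upperQuantile (hβ : 0 ≤ β) : (η : EReal) ≤ upperQuantile F β η := by
  have h0 : (0 : EReal) ≤ sSup {c : EReal | ∃ r : ℝ, c = (r : EReal) ∧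
      bootProb (fun ι => ((F ι : ℝ≥0∞) : EReal) ≤ (r : EReal)) ≤ β} := by
    refine EReal.ge_of_forall_gt_iff_ge.1 fun x hx => le_sSup ⟨x, rfl, ?_⟩
    rw [bootProb_false]
    · exact hβ
    · intro ι hι
      exact absurd (hι.trans_lt hx) (not_lt.2 (EReal.coe_ennreal_nonneg _))
  calc (η : EReal) = 0 + η := (zero_add _).symm
    _ ≤ _ := add_le_add h0 le_rfl

end CriticalValue

/-! ### Asymptotics of critical values and rejection probabilities. -/

section Limits

variable {Ω : Type*} [MeasurableSpace Ω] {Pr : Measure Ω}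
  {I : Type} {Γ : Measure (Linf I)} [IsProbabilityMeasure Γ]
  {Z : ℕ → Ω → I → ℝ} {Zs : (L : ℕ) → Ω → (Fin L → Fin L) → I → ℝ}
  {X : ℕ → Ω → ℝ≥0∞} {F : (L : ℕ) → Ω → (Fin L → Fin L) → ℝ≥0∞}
  {crit : ℕ → Ω → EReal} {β η : ℝ}

lemma measureReal_lt_eq {U : Linf I → ℝ} (hU : Measurable U) (a : ℝ) :
    Γ.real {z | a < U z} = 1 - Γ.real {z | U z ≤ a} := by
  have : {z | a < U z} = {z | U z ≤ a}ᶜ := by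
    ext z
    simp
  rw [this, measureReal_compl (measurableSet_le hU measurable_const)]
  simp

/-- Pointwise decreasing convergence `Un n → U` controls distribution functions. -/
lemma exists_cdf_gt {U : Linf I → ℝ} {Un : ℕ → Linf I → ℝ}
    (hanti : ∀ z, Antitone fun n => Un n z)
    (hlim : ∀ z, Tendsto (fun n => Un n z) atTop (𝓝 (U z))) {a b x : ℝ} (hab : a < b)
    (hx : x < Γ.real {z | U z ≤ a}) : ∃ n, x < Γ.real {z | Un n z ≤ b} := by
  have ht : Tendsto (fun n => Γ {z | Un n z ≤ b}) atTop (𝓝 (Γ (⋃ n, {z | Un n z ≤ b}))) :=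
    tendsto_measure_iUnion_atTop fun m n hmn z (hz : Un m z ≤ b) => (hanti z hmn).trans hz
  have hsub : {z | U z ≤ a} ⊆ ⋃ n, {z | Un n z ≤ b} := fun z (hz : U z ≤ a) => by
    obtain ⟨n, hn⟩ := ((hlim z).eventually (gt_mem_nhds (hz.trans_lt hab))).exists
    exact mem_iUnion.2 ⟨n, hn.le⟩
  have ht' := (ENNReal.tendsto_toReal (measure_ne_top Γ _)).comp ht
  exact (ht'.eventually (lt_mem_nhds (hx.trans_le (measureReal_mono hsub)))).exists

lemma exists_cdf_left {U : Linf I → ℝ} {t x : ℝ} (hx : x < Γ.real {z | U z < t}) :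
    ∃ a < t, x < Γ.real {z | U z ≤ a} := by
  obtain ⟨s, hs, hst, hlim⟩ := exists_seq_strictMono_tendsto t
  have ht : Tendsto (fun n => Γ {z | U z ≤ s n}) atTop (𝓝 (Γ (⋃ n, {z | U z ≤ s n}))) :=
    tendsto_measure_iUnion_atTop fun m n hmn z (hz : U z ≤ s m) => hz.trans (hs.monotone hmn)
  have hsub : {z | U z < t} ⊆ ⋃ n, {z | U z ≤ s n} := fun z (hz : U z < t) => by
    obtain ⟨n, hn⟩ := (hlim.eventually (lt_mem_nhds hz)).exists
    exact mem_iUnion.2 ⟨n, hn.le⟩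
  have ht' := (ENNReal.tendsto_toReal (measure_ne_top Γ _)).comp ht
  obtain ⟨n, hn⟩ := (ht'.eventually (lt_mem_nhds (hx.trans_le (measureReal_mono hsub)))).exists
  exact ⟨s n, hst n, hn⟩

lemma exists_tail_right {U : Linf I → ℝ} {t x : ℝ} (hx : x < Γ.real {z | t < U z}) :
    ∃ a > t, x < Γ.real {z | a ≤ U z} := by
  obtain ⟨s, hs, hst, hlim⟩ := exists_seq_strictAnti_tendsto t
  have ht : Tendsto (fun n => Γ {z | s n ≤ U z}) atTop (𝓝 (Γ (⋃ n, {z | s n ≤ U z}))) :=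
    tendsto_measure_iUnion_atTop fun m n hmn z (hz : s m ≤ U z) => (hs.antitone hmn).trans hz
  have hsub : {z | t < U z} ⊆ ⋃ n, {z | s n ≤ U z} := fun z (hz : t < U z) => by
    obtain ⟨n, hn⟩ := (hlim.eventually (gt_mem_nhds hz)).exists
    exact mem_iUnion.2 ⟨n, hn.le⟩
  have ht' := (ENNReal.tendsto_toReal (measure_ne_top Γ _)).comp ht
  obtain ⟨n, hn⟩ := (ht'.eventually (lt_mem_nhds (hx.trans_le (measureReal_mono hsub)))).exists
  exact ⟨s n, hst n, hn⟩

/-- Asymptotic lower bound for critical values. -/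
lemma withHighProb_le_upperQuantile (hboot : BootWeakConv Pr Zs Γ) {U : Linf I → ℝ} {K : NNReal}
    (hU : LipschitzWith K U)
    (hlow : ∀ a b : ℝ, 0 ≤ a → a < b → WithHighProb Pr fun L ω =>
      ∀ ι, F L ω ι ≤ ENNReal.ofReal (a ^ 2) → U (toLinf (Zs L ω ι)) ≤ b)
    {u v : ℝ} (hu : 0 ≤ u) (huv : u < v) (hv : Γ.real {z | U z ≤ v} < β) :
    WithHighProb Pr fun L ω => ((u ^ 2 + η : ℝ) : EReal) ≤ upperQuantile (F L ω) β η := by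
  -- One gap absorbs the error between the statistic and `U`, the other the error of the bootstrap
  -- law.
  obtain ⟨a, hua, hav⟩ := exists_between huv
  refine ((hlow u a hu hua).and (hboot.withHighProb_cdf_le hU hav (sub_pos.2 hv))).mono
    (Eventually.of_forall fun L ω hω => le_upperQuantile (by positivity) ?_)
  refine (bootProb_mono hω.1).trans (hω.2.trans ?_)
  linarith

/-- Asymptotic upper bound for critical values. -/
lemma withHighProb_upperQuantile_le (hboot : BootWeakConv Pr Zs Γ) {U : Linf I → ℝ} {K : NNReal}
    (hU : LipschitzWith K U)
    (hup : ∀ a b : ℝ, 0 ≤ a → a < b → WithHighProb Pr fun L ω =>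
      ∀ ι, U (toLinf (Zs L ω ι)) ≤ a → F L ω ι ≤ ENNReal.ofReal (b ^ 2))
    {u v : ℝ} (hv : 0 ≤ v) (huv : v < u) (hβ : β < Γ.real {z | U z ≤ v}) :
    WithHighProb Pr fun L ω => upperQuantile (F L ω) β η ≤ ((u ^ 2 + η : ℝ) : EReal) := by
  obtain ⟨a, hva, hau⟩ := exists_between huv
  refine ((hup a u (hv.trans hva.le) hau).and
    (hboot.withHighProb_cdf_ge hU hva (half_pos (sub_pos.2 hβ)))).mono
    (Eventually.of_forall fun L ω hω => upperQuantile_le (by positivity) ?_)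
  refine lt_of_lt_of_le ?_ (bootProb_mono hω.1)
  linarith [hω.2]

variable [IsProbabilityMeasure Pr]

lemma coe_real_lt_coe_ennreal {x : ℝ≥0∞} {r : ℝ} (hr : 0 ≤ r) :
    (r : EReal) < (x : EReal) ↔ ENNReal.ofReal r < x := by
  rw [← not_le, ← not_le, coe_ennreal_le_coe_real hr]

/-- Asymptotic upper bound for rejection probabilities. -/
lemma eventually_reject_le (hlim : WeakConv Pr Z Γ) {U : Linf I → ℝ} (hU : Measurable U)
    {Un : ℕ → Linf I → ℝ} (hUn : ∀ n, Continuous (Un n))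
    (hanti : ∀ z, Antitone fun n => Un n z)
    (hpt : ∀ z, Tendsto (fun n => Un n z) atTop (𝓝 (U z)))
    (hup : ∀ (n : ℕ) (a b : ℝ), 0 ≤ a → a < b → WithHighProb Pr fun L ω =>
      Un n (toLinf (Z L ω)) ≤ a → X L ω ≤ ENNReal.ofReal (b ^ 2))
    {t : ℝ} (ht : 0 < t) (hnull : Γ {z | U z = t} = 0)
    (hcrit : ∀ c, 0 ≤ c → c < t → WithHighProb Pr fun L ω => ((c ^ 2 : ℝ) : EReal) ≤ crit L ω)
    {e : ℝ} (he : 0 < e) :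
    ∀ᶠ L in atTop, Pr.real {ω | crit L ω < (X L ω : EReal)} ≤ Γ.real {z | t < U z} + e := by
  have hlt : Γ.real {z | U z < t} = Γ.real {z | U z ≤ t} := by
    refine measureReal_congr ?_
    have : ∀ᵐ z ∂Γ, ¬ U z = t := by
      rw [ae_iff]
      simpa only [not_not] using hnull
    filter_upwards [this] with z hz
    exact propext ⟨fun h => le_of_lt h, fun h => lt_of_le_of_ne h hz⟩
  obtain ⟨u, hut, hu⟩ := exists_cdf_left (Γ := Γ) (U := U) (t := t)
    (x := Γ.real {z | U z ≤ t} - e / 3) (by linarith)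
  -- Levels `u < a < b < c < t`: the gaps absorb in turn the passage from `U` to `Un n`, weak
  -- convergence, the variance estimator, and the critical value. No atom at `t` allows `u < t` with
  -- almost the same mass.
  obtain ⟨a, hua, hat⟩ := exists_between (max_lt hut ht)
  have ha0 : 0 < a := (le_max_right _ _).trans_lt hua
  obtain ⟨b, hab, hbt⟩ := exists_between hat
  obtain ⟨c, hbc, hct⟩ := exists_between hbt
  obtain ⟨n, hn⟩ := exists_cdf_gt hanti hpt ((le_max_left _ _).trans_lt hua) hu
  filter_upwards [hlim.eventually_le (hUn n) hab (show 0 < e / 3 by positivity),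
    ((hcrit c (by linarith) hct).and (hup n b c (by linarith) hbc)).eventually_real_le
      (show 0 < e / 3 by positivity)] with L h1 h2
  rw [measureReal_lt_eq (hUn n).measurable] at h1
  rw [measureReal_lt_eq hU]
  have hsub : {ω | crit L ω < (X L ω : EReal)} ⊆ {ω | b ≤ Un n (toLinf (Z L ω))} ∪
      {ω | ¬ (((c ^ 2 : ℝ) : EReal) ≤ crit L ω ∧
        (Un n (toLinf (Z L ω)) ≤ b → X L ω ≤ ENNReal.ofReal (c ^ 2)))} := by
    intro ω hω
    by_contra hcon
    simp only [mem_union, mem_ofPred_eq, not_or, not_le, not_not] at hcon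
    have h3 := hcon.2.2 hcon.1.le
    have h4 := (coe_ennreal_le_coe_real (by positivity)).2 h3
    exact absurd (hcon.2.1.trans_lt hω) (not_lt.2 h4)
  have h5 := (measureReal_mono hsub (μ := Pr)).trans (measureReal_union_le _ _)
  linarith

/-- Asymptotic lower bound for rejection probabilities. -/
lemma eventually_reject_ge (hlim : WeakConv Pr Z Γ) {U : Linf I → ℝ} (hU : Continuous U)
    (hlow : ∀ a b : ℝ, 0 ≤ a → a < b → WithHighProb Pr fun L ω =>
      X L ω ≤ ENNReal.ofReal (a ^ 2) → U (toLinf (Z L ω)) ≤ b)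
    {t : ℝ} (ht : 0 ≤ t)
    (hcrit : ∀ c, t < c → WithHighProb Pr fun L ω => crit L ω ≤ ((c ^ 2 : ℝ) : EReal))
    {e : ℝ} (he : 0 < e) :
    ∀ᶠ L in atTop, Γ.real {z | t < U z} - e ≤ Pr.real {ω | crit L ω < (X L ω : EReal)} := by
  obtain ⟨u, hut, hu⟩ := exists_tail_right (Γ := Γ) (U := U) (t := t)
    (x := Γ.real {z | t < U z} - e / 3) (by linarith)
  obtain ⟨c, htc, hcu⟩ := exists_between hut
  obtain ⟨b, hcb, hbu⟩ := exists_between hcu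
  filter_upwards [hlim.eventually_ge hU hbu (show 0 < e / 3 by positivity),
    ((hcrit c htc).and (hlow c b (by linarith) hcb)).eventually_real_le
      (show 0 < e / 3 by positivity)] with L h1 h2
  have hsub : {ω | b < U (toLinf (Z L ω))} ⊆ {ω | crit L ω < (X L ω : EReal)} ∪
      {ω | ¬ (crit L ω ≤ ((c ^ 2 : ℝ) : EReal) ∧
        (X L ω ≤ ENNReal.ofReal (c ^ 2) → U (toLinf (Z L ω)) ≤ b))} := by
    intro ω hω
    by_contra hcon
    simp only [mem_union, mem_ofPred_eq, not_or, not_lt, not_not] at hcon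
    have h3 : X L ω ≤ ENNReal.ofReal (c ^ 2) :=
      (coe_ennreal_le_coe_real (by positivity)).1 (hcon.1.trans hcon.2.1)
    exact absurd hω (not_lt.2 (hcon.2.2 h3))
  have h5 := (measureReal_mono hsub (μ := Pr)).trans (measureReal_union_le _ _)
  linarith

/-- Consistency: bounded critical values and a diverging test statistic. -/
lemma tendsto_reject_one {R : ℝ} (hR : 0 ≤ R)
    (hcrit : WithHighProb Pr fun L ω => crit L ω ≤ (R : EReal))
    (hX : WithHighProb Pr fun L ω => ENNReal.ofReal R < X L ω) :
    Tendsto (fun L => Pr.real {ω | crit L ω < (X L ω : EReal)}) atTop (𝓝 1) := by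
  have h := hcrit.and hX
  refine tendsto_order.2 ⟨fun x hx => ?_, fun x hx => Eventually.of_forall fun L =>
    measureReal_le_one.trans_lt hx⟩
  filter_upwards [h.eventually_real_le (half_pos (sub_pos.2 hx))] with L hL
  have hsub : (univ : Set Ω) ⊆ {ω | crit L ω < (X L ω : EReal)} ∪
      {ω | ¬ (crit L ω ≤ (R : EReal) ∧ ENNReal.ofReal R < X L ω)} := by
    intro ω _
    by_contra hcon
    simp only [mem_union, mem_ofPred_eq, not_or, not_not] at hcon
    exact hcon.1 (hcon.2.1.trans_lt ((coe_real_lt_coe_ennreal hR).2 hcon.2.2))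
  have h5 := (measureReal_mono hsub (μ := Pr)).trans (measureReal_union_le _ _)
  rw [probReal_univ] at h5
  linarith

end Limits

/-! ### Comparison of estimated and limiting weights. -/

section Weights

variable {I : Type} {Q v m x c : I → ℝ} {θ a b : ℝ}

/-- A relative error `θ` in the variances is paid for by the gap between `a` and `b`. The value is
chosen so that `θ b²` is half of `b² - a²`. -/
lemma exists_slack (ha : 0 ≤ a) (hab : a < b) :
    ∃ θ : ℝ, 0 < θ ∧ θ ≤ 1 / 2 ∧ a ^ 2 ≤ (1 - θ) * b ^ 2 ∧ (1 + θ) * a ^ 2 ≤ b ^ 2 := by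
  have hb : 0 < b ^ 2 := by
    have := ha.trans_lt hab
    positivity
  have hab2 : a ^ 2 < b ^ 2 := pow_lt_pow_left₀ hab ha two_ne_zero
  have ht : (b ^ 2 - a ^ 2) / (2 * b ^ 2) * b ^ 2 = (b ^ 2 - a ^ 2) / 2 := by
    have := (ha.trans_lt hab).ne'
    field_simp
  have hpos : 0 < (b ^ 2 - a ^ 2) / (2 * b ^ 2) := div_pos (by linarith) (by positivity)
  refine ⟨(b ^ 2 - a ^ 2) / (2 * b ^ 2), hpos, ?_, by linarith, ?_⟩
  · rw [div_le_iff₀ (by positivity)]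
    have := sq_nonneg a
    linarith
  · have := mul_le_mul_of_nonneg_left hab2.le hpos.le
    linarith

lemma cvm_div_sqrt (hm : ∀ p, 0 < m p) :
    cvm Q (fun p => x p / √(m p)) = cvm (fun p => Q p / m p) x := by
  rw [cvm_div fun p => Real.sqrt_pos.2 (hm p)]
  simp only [Real.sq_sqrt (hm _).le]

/-- Upper bound for a studentized Cramér–von Mises statistic. -/
lemma cvm_div_sqrt_le (hQ : ∀ p, 0 ≤ Q p) (hv : ∀ p, 0 < v p) (hs : Summable fun p => Q p / v p)
    (hθ : θ < 1) (hm : ∀ p, (1 - θ) * v p ≤ m p) (hc : ∀ p, c p ≤ 0) {z : Linf I}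
    (hx : ∀ p, x p ≤ z p + c p) (hz : cvmRoot (fun p => Q p / v p) c z ≤ a)
    (hab : a ^ 2 ≤ (1 - θ) * b ^ 2) :
    cvm Q (fun p => x p / √(m p)) ≤ ENNReal.ofReal (b ^ 2) := by
  have hθ' : 0 < 1 - θ := by linarith
  have hm0 : ∀ p, 0 < m p := fun p => (mul_pos hθ' (hv p)).trans_le (hm p)
  have hw : ∀ p, 0 ≤ Q p / v p := fun p => div_nonneg (hQ p) (hv p).le
  have h1 : cvm (fun p => Q p / m p) x ≤ cvm (fun p => (1 - θ)⁻¹ * (Q p / v p)) x := by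
    refine cvm_le_cvm fun p => mul_le_mul_of_nonneg_left ?_ (by positivity)
    have e : (1 - θ)⁻¹ * (Q p / v p) = Q p / ((1 - θ) * v p) := by
      have := (hv p).ne'
      field_simp
    rw [e]
    exact div_le_div_of_nonneg_left (hQ p) (mul_pos hθ' (hv p)) (hm p)
  rw [cvm_div_sqrt hm0]
  refine h1.trans ?_
  rw [cvm_const_mul (inv_nonneg.2 hθ'.le)]
  calc ENNReal.ofReal (1 - θ)⁻¹ * cvm (fun p => Q p / v p) x
      ≤ ENNReal.ofReal (1 - θ)⁻¹ * cvm (fun p => Q p / v p) (fun p => z p + c p) := by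
        gcongr
        exact cvm_mono hw hx
    _ = ENNReal.ofReal ((1 - θ)⁻¹ * cvmRoot (fun p => Q p / v p) c z ^ 2) := by
        rw [cvm_eq_cvmRoot hw hs hc, ← ENNReal.ofReal_mul (inv_nonneg.2 hθ'.le)]
    _ ≤ ENNReal.ofReal (b ^ 2) := by
        refine ENNReal.ofReal_le_ofReal ?_
        rw [inv_mul_le_iff₀ hθ']
        exact (pow_le_pow_left₀ (cvmRoot_nonneg z) hz 2).trans hab

/-- Lower bound for a studentized Cramér–von Mises statistic by the part of the sum where a
reduced weight `w` is supported. -/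
lemma cvmRoot_le_of_cvm_div_sqrt_le {w : I → ℝ} (hv : ∀ p, 0 < v p)
    (hw : ∀ p, 0 ≤ w p) (hs : Summable w) (hθ : 0 < θ) (hm0 : ∀ p, 0 < m p)
    (hm : ∀ p, m p ≤ (1 + θ) * v p) {z : Linf I} (hQ : ∀ p, 0 ≤ Q p)
    (hx : ∀ p, w p = 0 ∨ (w p = Q p / v p ∧ z p ≤ x p)) (hb : 0 ≤ b)
    (hcvm : cvm Q (fun p => x p / √(m p)) ≤ ENNReal.ofReal (a ^ 2))
    (hab : (1 + θ) * a ^ 2 ≤ b ^ 2) : cvmRoot w (fun _ => 0) z ≤ b := by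
  have hθ' : 0 < 1 + θ := by linarith
  rw [cvm_div_sqrt hm0] at hcvm
  have h1 : cvm (fun p => (1 + θ)⁻¹ * w p) (fun p => z p) ≤ cvm (fun p => Q p / m p) x := by
    refine cvm_le_cvm fun p => ?_
    have hq : 0 ≤ Q p / m p := div_nonneg (hQ p) (hm0 p).le
    rcases hx p with h | ⟨h, hzx⟩
    · rw [h, mul_zero, mul_zero]
      positivity
    · have e : (1 + θ)⁻¹ * w p ≤ Q p / m p := by
        have e' : (1 + θ)⁻¹ * w p = Q p / ((1 + θ) * v p) := by
          have := (hv p).ne'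
          rw [h]
          field_simp
        rw [e']
        exact div_le_div_of_nonneg_left (hQ p) (hm0 p) (hm p)
      have e2 := pow_le_pow_left₀ (le_max_right _ _) (max_le_max_right 0 hzx) 2
      have := hw p
      exact mul_le_mul e2 e (by positivity) (by positivity)
  have h2 := h1.trans hcvm
  rw [cvm_const_mul (inv_nonneg.2 hθ'.le), cvm_coe_eq hw hs,
    ← ENNReal.ofReal_mul (inv_nonneg.2 hθ'.le), ENNReal.ofReal_le_ofReal_iff (by positivity),
    inv_mul_le_iff₀ hθ'] at h2
  exact (pow_le_pow_iff_left₀ (cvmRoot_nonneg z) hb two_ne_zero).1 (h2.trans hab)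

end Weights

/-! ### Finite truncation of the slack moments. -/

section Selection

variable {I : Type} {w ν : I → ℝ} {f : I → ℕ}

open Classical in
variable (w ν) in
/-- The weights restricted to the moments that are not negative. -/
noncomputable def bindingWeight (p : I) : ℝ := if ν p < 0 then 0 else w p

open Classical in
variable (ν f) in
/-- A recentering that pushes finitely many of the slack moments down by `n`. -/
noncomputable def slackShift (n : ℕ) (p : I) : ℝ := if ν p < 0 ∧ f p ≤ n then -(n : ℝ) else 0

lemma slackShift_nonpos (n : ℕ) (p : I) : slackShift ν f n p ≤ 0 := by
  unfold slackShift
  split_ifs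
  · simp
  · rfl

lemma bindingWeight_nonneg (hw : ∀ p, 0 ≤ w p) (p : I) : 0 ≤ bindingWeight w ν p := by
  unfold bindingWeight
  split_ifs
  · rfl
  · exact hw p

lemma summable_bindingWeight (hw : ∀ p, 0 ≤ w p) (hs : Summable w) :
    Summable (bindingWeight w ν) := by
  refine Summable.of_nonneg_of_le (bindingWeight_nonneg hw) (fun p => ?_) hs
  unfold bindingWeight
  split_ifs
  · exact hw p
  · rfl

lemma antitone_cvmRoot_slackShift (hw : ∀ p, 0 ≤ w p) (hs : Summable w) (z : Linf I) :
    Antitone fun n => cvmRoot w (slackShift ν f n) z := by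
  intro n k hnk
  refine Real.sqrt_le_sqrt (Summable.tsum_le_tsum (fun p => ?_)
    (summable_shift hw hs (slackShift_nonpos k) z) (summable_shift hw hs (slackShift_nonpos n) z))
  have h : slackShift ν f k p ≤ slackShift ν f n p := by
    have hnk' : (n : ℝ) ≤ k := by exact_mod_cast hnk
    by_cases h1 : ν p < 0 ∧ f p ≤ n
    · simp only [slackShift, h1, h1.2.trans hnk, and_self, if_true]
      linarith
    · rw [show slackShift ν f n p = 0 from if_neg h1]
      exact slackShift_nonpos k p
  exact mul_le_mul_of_nonneg_right (pow_le_pow_left₀ (le_max_right _ _)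
    (max_le_max_right 0 (by linarith)) 2) (hw p)

/-- A slack term vanishes once its index is included and `n` exceeds `‖z‖`; dominated convergence
with bound `‖z‖² w` handles the sum. -/
lemma tendsto_cvmRoot_slackShift (hw : ∀ p, 0 ≤ w p) (hs : Summable w) (z : Linf I) :
    Tendsto (fun n => cvmRoot w (slackShift ν f n) z) atTop
      (𝓝 (cvmRoot (bindingWeight w ν) (fun _ => 0) z)) := by
  refine (Real.continuous_sqrt.tendsto _).comp ?_
  refine tendsto_tsum_of_dominated_convergence (hs.mul_left (‖z‖ ^ 2)) (fun p => ?_)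
    (Eventually.of_forall fun n p => ?_)
  · by_cases hp : ν p < 0
    · refine tendsto_const_nhds.congr' ?_
      filter_upwards [eventually_ge_atTop (f p), eventually_ge_atTop ⌈‖z‖⌉₊] with n h1 h2
      have h3 : ‖z‖ ≤ n := (Nat.le_ceil _).trans (by exact_mod_cast h2)
      have h4 := (abs_le.1 (abs_coord_le z p)).2
      have h5 : max (z p + slackShift ν f n p) 0 = 0 := by
        refine max_eq_right ?_
        simp only [slackShift, hp, h1, and_self, if_true]
        linarith
      rw [h5]
      simp [bindingWeight, hp]
    · simp [slackShift, bindingWeight, hp]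
  · have := hw p
    rw [Real.norm_eq_abs, abs_of_nonneg (by positivity)]
    exact mul_le_mul_of_nonneg_right (pow_le_pow_left₀ (le_max_right _ _)
      (max_add_le (slackShift_nonpos n) z p) 2) this

end Selection

/-! ### Sandwich bounds for the test and bootstrap statistics. -/

section Sandwich

variable {Ω : Type*} [MeasurableSpace Ω] {Pr : Measure Ω}
  {N : ℕ} {bl bu : ℝ} {hb : bl < bu} {B : ℕ → Fin N → Ω → ℝ} {Mhat What : Estimator N}
  {s2hat : ℕ → Ω → Idx bl bu → ℝ} {κ : Idx bl bu → Idx bl bu → ℝ} {Q ν : Idx bl bu → ℝ}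
  {kap beta : ℕ → ℝ} {ε θ : ℝ} {Γ : Measure (Linf (Idx bl bu))}

variable (hb κ ε) in
/-- The limit `max {σ², ε σ²(reference index)}` of the regularized variance estimator. -/
noncomputable def limitVar (p : Idx bl bu) : ℝ := max (κ p p) (ε * κ (refIdx hb) (refIdx hb))

variable (Q hb κ ε) in
/-- The weights of the limit statistic. -/
noncomputable def limitWeight (p : Idx bl bu) : ℝ := Q p / limitVar hb κ ε p

lemma limitVar_pos (hε : 0 < ε) (href : 0 < κ (refIdx hb) (refIdx hb)) (p : Idx bl bu) :
    0 < limitVar hb κ ε p := lt_max_of_lt_right (mul_pos hε href)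

lemma limitWeight_pos (hε : 0 < ε) (href : 0 < κ (refIdx hb) (refIdx hb)) (hQ : ∀ p, 0 < Q p)
    (p : Idx bl bu) : 0 < limitWeight hb κ Q ε p := div_pos (hQ p) (limitVar_pos hε href p)

lemma summable_limitWeight (hε : 0 < ε) (href : 0 < κ (refIdx hb) (refIdx hb))
    (hQ : ∀ p, 0 < Q p) (hs : Summable Q) : Summable (limitWeight hb κ Q ε) := by
  refine Summable.of_nonneg_of_le (fun p => (limitWeight_pos hε href hQ p).le) (fun p => ?_)
    (hs.div_const (ε * κ (refIdx hb) (refIdx hb)))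
  exact div_le_div_of_nonneg_left (hQ p).le (mul_pos hε href) (le_max_right _ _)

/-- The regularized variance estimator is uniformly close to its limit, in relative terms. -/
lemma UniformlyConsistent.withHighProb_ratio (hvar : UniformlyConsistent Pr s2hat fun p => κ p p)
    (hε : 0 < ε) (href : 0 < κ (refIdx hb) (refIdx hb)) (hθ : 0 < θ) :
    WithHighProb Pr fun L ω => ∀ p,
      (1 - θ) * limitVar hb κ ε p ≤ max (s2hat L ω p) (ε * s2hat L ω (refIdx hb)) ∧
      max (s2hat L ω p) (ε * s2hat L ω (refIdx hb)) ≤ (1 + θ) * limitVar hb κ ε p := by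
  set k := κ (refIdx hb) (refIdx hb)
  -- An error of this size, multiplied by `1` or by `ε`, is at most `θ ε k`, hence at most `θ` times
  -- the limiting variance.
  have hδ : 0 < θ * (ε * k) / (1 + ε) := by positivity
  have h : WithHighProb Pr fun L ω => ∀ p, |s2hat L ω p - κ p p| ≤ θ * (ε * k) / (1 + ε) := by
    refine (hvar _ hδ).congr fun L => ?_
    simp only [not_forall, not_le]
  refine h.mono (Eventually.of_forall fun L ω hω p => ?_)
  set δ := θ * (ε * k) / (1 + ε)
  have hδe : (1 + ε) * δ = θ * (ε * k) := by
    simp only [δ]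
    field_simp
  have h1 := abs_max_sub_max_le_max (s2hat L ω p) (ε * s2hat L ω (refIdx hb)) (κ p p) (ε * k)
  have h2 : |ε * s2hat L ω (refIdx hb) - ε * k| ≤ ε * δ := by
    rw [← mul_sub, abs_mul, abs_of_pos hε]
    exact mul_le_mul_of_nonneg_left (hω _) hε.le
  have h3 : ε * k ≤ limitVar hb κ ε p := le_max_right _ _
  have h4 : |max (s2hat L ω p) (ε * s2hat L ω (refIdx hb)) - limitVar hb κ ε p|
      ≤ θ * limitVar hb κ ε p := by
    refine h1.trans (max_le ((hω p).trans ?_) (h2.trans ?_))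
    · nlinarith
    · nlinarith
  have h5 := abs_le.1 h4
  constructor <;> linarith [h5.1, h5.2]

/-- Noise plus drift: the form in which the sign of `ν` decides the fate of a moment. -/
lemma studentized_eq {L : ℕ} (s : Idx bl bu → ℝ) (x : Sample N L) (p : Idx bl bu) :
    studentized Mhat What s x p
      = (estProcess Mhat What ν x p + sqrtS N L * ν p) / s p := by
  simp only [studentized, estProcess]
  ring

lemma gms_nonpos (hGMS : GMSRates kap beta) {L : ℕ} (s : Idx bl bu → ℝ) (x : Sample N L)
    (p : Idx bl bu) : gms Mhat What kap beta s x p ≤ 0 := by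
  have := hGMS.beta_pos (N * L)
  unfold gms
  split_ifs <;> linarith

lemma tendsto_mul_atTop (hN : 1 ≤ N) : Tendsto (fun L : ℕ => N * L) atTop atTop :=
  tendsto_id.const_mul_atTop' hN

lemma tendsto_sqrtS (hN : 1 ≤ N) : Tendsto (sqrtS N) atTop atTop :=
  Real.tendsto_sqrt_atTop.comp (tendsto_natCast_atTop_atTop.comp (tendsto_mul_atTop hN))

lemma bootStat_eq {L : ℕ} {s : Idx bl bu → ℝ} (hs : ∀ p, 0 < s p) (x : Sample N L)
    (ι : Fin L → Fin L) :
    bootStat Mhat What kap beta Q s x ι = cvm Q fun p =>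
      (bootProcess Mhat What x ι p + s p * gms Mhat What kap beta s x p) / s p := by
  unfold bootStat
  congr 1
  funext p
  have := (hs p).ne'
  field_simp

/-- Bounds for the test statistic: the recentred estimation process dominates it when `ν ≤ 0`. -/
lemma testStat_le (hN : 1 ≤ N) (hν : ∀ p, ν p ≤ 0)
    (hlim : WeakConv Pr (fun L ω => estProcess Mhat What ν (sample B L ω)) Γ)
    (hvar : UniformlyConsistent Pr s2hat fun p => κ p p) (hε : 0 < ε)
    (href : 0 < κ (refIdx hb) (refIdx hb)) (hQ : ∀ p, 0 < Q p) (hs : Summable Q)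
    {f : Idx bl bu → ℕ} (hf : f.Injective) (n : ℕ) {a b : ℝ} (ha : 0 ≤ a) (hab : a < b) :
    WithHighProb Pr fun L ω =>
      cvmRoot (limitWeight hb κ Q ε) (slackShift ν f n)
        (toLinf (estProcess Mhat What ν (sample B L ω))) ≤ a →
      testStat Mhat What Q (sigmaEps hb ε (s2hat L ω)) (sample B L ω) ≤ ENNReal.ofReal (b ^ 2) := by
  obtain ⟨θ, hθ, hθ2, h1, h2⟩ := exists_slack ha hab
  -- Finiteness makes the drift of the selected slack moments fall below `-n` simultaneously; the
  -- other moments only need drift `≤ 0`.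
  have hfin : {p | f p ≤ n}.Finite := (finite_Iic n).preimage hf.injOn
  have hev : ∀ᶠ L in atTop, ∀ p ∈ {p | f p ≤ n}, ν p < 0 → sqrtS N L * ν p ≤ -n := by
    refine (hfin.eventually_all).2 fun p hp => ?_
    by_cases hp0 : ν p < 0
    · filter_upwards [((tendsto_sqrtS hN).atTop_mul_const_of_neg hp0).eventually_le_atBot (-(n : ℝ))]
        with L hL _ using hL
    · exact Eventually.of_forall fun L h => absurd h hp0
  refine (hvar.withHighProb_ratio (hb := hb) hε href hθ).mono ?_
  filter_upwards [hev] with L hL ω hω hroot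
  have key := cvm_div_sqrt_le (θ := θ) (b := b) (fun p => (hQ p).le) (limitVar_pos hε href)
    (summable_limitWeight hε href hQ hs) (by linarith) (fun p => (hω p).1)
    (slackShift_nonpos n)
    (x := fun p => estProcess Mhat What ν (sample B L ω) p + sqrtS N L * ν p)
    (fun p => ?_) hroot h1
  · unfold testStat
    rw [show studentized Mhat What (sigmaEps hb ε (s2hat L ω)) (sample B L ω) = _ from
      funext fun p => studentized_eq (ν := ν) _ _ p]
    exact key
  · rw [coe_toLinf (hlim.bounded L ω)]
    have h0 : sqrtS N L * ν p ≤ 0 :=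
      mul_nonpos_of_nonneg_of_nonpos (Real.sqrt_nonneg _) (hν p)
    unfold slackShift
    split_ifs with h
    · linarith [hL p h.2 h.1]
    · linarith

/-- The test statistic dominates the part of the limit functional at nonnegative moments. -/
lemma le_testStat
    (hlim : WeakConv Pr (fun L ω => estProcess Mhat What ν (sample B L ω)) Γ)
    (hvar : UniformlyConsistent Pr s2hat fun p => κ p p) (hε : 0 < ε)
    (href : 0 < κ (refIdx hb) (refIdx hb)) (hQ : ∀ p, 0 < Q p) (hs : Summable Q)
    {a b : ℝ} (ha : 0 ≤ a) (hab : a < b) :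
    WithHighProb Pr fun L ω =>
      testStat Mhat What Q (sigmaEps hb ε (s2hat L ω)) (sample B L ω) ≤ ENNReal.ofReal (a ^ 2) →
      cvmRoot (bindingWeight (limitWeight hb κ Q ε) ν) (fun _ => 0)
        (toLinf (estProcess Mhat What ν (sample B L ω))) ≤ b := by
  obtain ⟨θ, hθ, hθ2, h1, h2⟩ := exists_slack ha hab
  have hw : ∀ p, 0 ≤ limitWeight hb κ Q ε p := fun p => (limitWeight_pos hε href hQ p).le
  refine (hvar.withHighProb_ratio (hb := hb) hε href hθ).mono
    (Eventually.of_forall fun L ω hω hle => ?_)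
  refine cvmRoot_le_of_cvm_div_sqrt_le (limitVar_pos hε href) (bindingWeight_nonneg hw)
    (summable_bindingWeight hw (summable_limitWeight hε href hQ hs)) hθ
    (fun p => lt_of_lt_of_le (mul_pos (by linarith) (limitVar_pos hε href p)) (hω p).1)
    (fun p => (hω p).2) (fun p => (hQ p).le)
    (x := fun p => estProcess Mhat What ν (sample B L ω) p + sqrtS N L * ν p)
    (fun p => ?_) (ha.trans hab.le) ?_ h2
  · rw [coe_toLinf (hlim.bounded L ω)]
    unfold bindingWeight
    split_ifs with h
    · exact Or.inl rfl
    · refine Or.inr ⟨rfl, ?_⟩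
      have : 0 ≤ sqrtS N L * ν p := mul_nonneg (Real.sqrt_nonneg _) (not_lt.1 h)
      linarith
  · unfold testStat at hle
    rwa [show studentized Mhat What (sigmaEps hb ε (s2hat L ω)) (sample B L ω) = _ from
      funext fun p => studentized_eq (ν := ν) _ _ p] at hle

variable [IsProbabilityMeasure Pr] [IsProbabilityMeasure Γ]

/-- Moment selection keeps all nonnegative moments. -/
lemma withHighProb_gms_eq_zero (hN : 1 ≤ N) (hGMS : GMSRates kap beta)
    (hlim : WeakConv Pr (fun L ω => estProcess Mhat What ν (sample B L ω)) Γ)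
    (hvar : UniformlyConsistent Pr s2hat fun p => κ p p) (hε : 0 < ε)
    (href : 0 < κ (refIdx hb) (refIdx hb)) :
    WithHighProb Pr fun L ω => ∀ p, 0 ≤ ν p →
      gms Mhat What kap beta (sigmaEps hb ε (s2hat L ω)) (sample B L ω) p = 0 := by
  -- A uniform lower bound for `σ̂_{ν,ε}` once the relative variance error is at most one half. The
  -- noise stays below `κ_S σ` because `κ_S → ∞`.
  set σ := √(1 / 2 * (ε * κ (refIdx hb) (refIdx hb)))
  have hσ : 0 < σ := Real.sqrt_pos.2 (by positivity)
  have hk : Tendsto (fun L => kap (N * L) * σ) atTop atTop :=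
    (hGMS.kap_tendsto.comp (tendsto_mul_atTop hN)).atTop_mul_const hσ
  refine ((hvar.withHighProb_ratio (hb := hb) hε href (show (0 : ℝ) < 1 / 2 by norm_num)).and
    (hlim.withHighProb_norm_le hk)).mono (Eventually.of_forall fun L ω hω p hp => ?_)
  have hs : σ ≤ sigmaEps hb ε (s2hat L ω) p := by
    refine Real.sqrt_le_sqrt (le_trans ?_ (hω.1 p).1)
    have : ε * κ (refIdx hb) (refIdx hb) ≤ limitVar hb κ ε p := le_max_right _ _
    linarith
  have hnot : ¬ studentized Mhat What (sigmaEps hb ε (s2hat L ω)) (sample B L ω) p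
      < -kap (N * L) := by
    rw [studentized_eq (ν := ν), not_lt, le_div_iff₀ (hσ.trans_le hs)]
    have h1 := (abs_le.1 (abs_coord_le (toLinf (estProcess Mhat What ν (sample B L ω))) p)).1
    rw [coe_toLinf (hlim.bounded L ω)] at h1
    have h2 : 0 ≤ sqrtS N L * ν p := mul_nonneg (Real.sqrt_nonneg _) hp
    have h3 := mul_le_mul_of_nonneg_left hs (hGMS.kap_pos (N * L)).le
    have h4 := hω.2
    linarith
  simp [gms, hnot]

/-- Moment selection removes any finite set of negative moments. -/
lemma withHighProb_gms_eq_neg (hN : 1 ≤ N) (hGMS : GMSRates kap beta)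
    (hlim : WeakConv Pr (fun L ω => estProcess Mhat What ν (sample B L ω)) Γ)
    (hvar : UniformlyConsistent Pr s2hat fun p => κ p p) (hε : 0 < ε)
    (href : 0 < κ (refIdx hb) (refIdx hb)) {J : Set (Idx bl bu)} (hJ : J.Finite)
    (hν : ∀ p ∈ J, ν p < 0) :
    WithHighProb Pr fun L ω => ∀ p ∈ J,
      gms Mhat What kap beta (sigmaEps hb ε (s2hat L ω)) (sample B L ω) p = -beta (N * L) := by
  have hk : Tendsto (fun L => kap (N * L)) atTop atTop :=
    hGMS.kap_tendsto.comp (tendsto_mul_atTop hN)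
  have hrate : Tendsto (fun L => kap (N * L) / sqrtS N L) atTop (𝓝 0) :=
    hGMS.kap_rate.comp (tendsto_mul_atTop hN)
  -- Since `κ_S / √S → 0`, the drift eventually beats both the noise, bounded by `κ_S`, and the
  -- selection threshold times `σ̂_{ν,ε}`.
  have hev : ∀ᶠ L in atTop, ∀ p ∈ J,
      kap (N * L) + kap (N * L) * √((1 + 1 / 2) * limitVar hb κ ε p) < -(sqrtS N L * ν p) := by
    refine hJ.eventually_all.2 fun p hp => ?_
    have h1 : Tendsto (fun L => kap (N * L) / sqrtS N L * (1 + √((1 + 1 / 2) * limitVar hb κ ε p)))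
        atTop (𝓝 0) := by simpa using hrate.mul_const (1 + √((1 + 1 / 2) * limitVar hb κ ε p))
    filter_upwards [h1.eventually (gt_mem_nhds (neg_pos.2 (hν p hp))),
      (tendsto_sqrtS hN).eventually_gt_atTop 0] with L hL hS
    rw [div_mul_eq_mul_div, div_lt_iff₀ hS] at hL
    linarith
  refine ((hvar.withHighProb_ratio (hb := hb) hε href (show (0 : ℝ) < 1 / 2 by norm_num)).and
    (hlim.withHighProb_norm_le hk)).mono ?_
  filter_upwards [hev] with L hL ω hω p hp
  have hpos : 0 < sigmaEps hb ε (s2hat L ω) p :=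
    Real.sqrt_pos.2 (lt_of_lt_of_le (mul_pos (by norm_num) (limitVar_pos hε href p)) (hω.1 p).1)
  have hs : sigmaEps hb ε (s2hat L ω) p ≤ √((1 + 1 / 2) * limitVar hb κ ε p) :=
    Real.sqrt_le_sqrt (hω.1 p).2
  have hlt : studentized Mhat What (sigmaEps hb ε (s2hat L ω)) (sample B L ω) p
      < -kap (N * L) := by
    rw [studentized_eq (ν := ν), div_lt_iff₀ hpos]
    have h1 := (abs_le.1 (abs_coord_le (toLinf (estProcess Mhat What ν (sample B L ω))) p)).2
    rw [coe_toLinf (hlim.bounded L ω)] at h1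
    have h3 := mul_le_mul_of_nonneg_left hs (hGMS.kap_pos (N * L)).le
    have h4 := hω.2
    have h5 := hL p hp
    linarith
  simp [gms, hlt]

/-- Selection shifts finitely many slack moments by `-β_S σ̂_{ν,ε}`, which falls below `-n` as `β_S
→ ∞`; elsewhere it can only lower the statistic. No sign condition on `ν` is needed, so the bound
also serves the alternative. -/
lemma bootStat_le (hN : 1 ≤ N) (hGMS : GMSRates kap beta)
    (hlim : WeakConv Pr (fun L ω => estProcess Mhat What ν (sample B L ω)) Γ)
    (hboot : BootWeakConv Pr (fun L ω ι => bootProcess (bl := bl) (bu := bu) Mhat What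
      (sample B L ω) ι) Γ)
    (hvar : UniformlyConsistent Pr s2hat fun p => κ p p) (hε : 0 < ε)
    (href : 0 < κ (refIdx hb) (refIdx hb)) (hQ : ∀ p, 0 < Q p) (hs : Summable Q)
    {f : Idx bl bu → ℕ} (hf : f.Injective) (n : ℕ) {a b : ℝ} (ha : 0 ≤ a) (hab : a < b) :
    WithHighProb Pr fun L ω => ∀ ι,
      cvmRoot (limitWeight hb κ Q ε) (slackShift ν f n)
        (toLinf (bootProcess Mhat What (sample B L ω) ι)) ≤ a →
      bootStat Mhat What kap beta Q (sigmaEps hb ε (s2hat L ω)) (sample B L ω) ι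
        ≤ ENNReal.ofReal (b ^ 2) := by
  obtain ⟨θ, hθ, hθ2, h1, h2⟩ := exists_slack ha hab
  set J := {p | f p ≤ n} ∩ {p | ν p < 0}
  have hfin : J.Finite := ((finite_Iic n).preimage hf.injOn).subset inter_subset_left
  set σ := √(1 / 2 * (ε * κ (refIdx hb) (refIdx hb)))
  have hσ : 0 < σ := Real.sqrt_pos.2 (by positivity)
  have hbt : Tendsto (fun L => σ * beta (N * L)) atTop atTop :=
    (hGMS.beta_tendsto.comp (tendsto_mul_atTop hN)).const_mul_atTop hσ
  refine ((hvar.withHighProb_ratio (hb := hb) hε href hθ).and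
    (withHighProb_gms_eq_neg hN hGMS hlim hvar hε href hfin fun p hp => hp.2)).mono ?_
  filter_upwards [hbt.eventually_ge_atTop (n : ℝ)] with L hL ω hω ι hroot
  have hsig : ∀ p, σ ≤ sigmaEps hb ε (s2hat L ω) p := fun p => by
    refine Real.sqrt_le_sqrt (le_trans ?_ (hω.1 p).1)
    have h3 : ε * κ (refIdx hb) (refIdx hb) ≤ limitVar hb κ ε p := le_max_right _ _
    have h4 := limitVar_pos hε href p
    nlinarith
  have hpos : ∀ p, 0 < sigmaEps hb ε (s2hat L ω) p := fun p => hσ.trans_le (hsig p)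
  rw [bootStat_eq hpos]
  refine cvm_div_sqrt_le (θ := θ) (b := b) (fun p => (hQ p).le) (limitVar_pos hε href)
    (summable_limitWeight hε href hQ hs) (by linarith) (fun p => (hω.1 p).1)
    (slackShift_nonpos n) (fun p => ?_) hroot h1
  rw [coe_toLinf (hboot.bounded L ω ι)]
  unfold slackShift
  split_ifs with h
  · rw [hω.2 p ⟨h.2, h.1⟩]
    have := mul_le_mul_of_nonneg_right (hsig p) (hGMS.beta_pos (N * L)).le
    linarith
  · have := mul_nonpos_of_nonneg_of_nonpos (hpos p).le
      (gms_nonpos (Mhat := Mhat) (What := What) hGMS (sigmaEps hb ε (s2hat L ω)) (sample B L ω) p)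
    linarith

/-- On moments with `ν ≥ 0` the selection shift vanishes with high probability, and dropping the
others lowers the sum. -/
lemma le_bootStat (hN : 1 ≤ N) (hGMS : GMSRates kap beta)
    (hlim : WeakConv Pr (fun L ω => estProcess Mhat What ν (sample B L ω)) Γ)
    (hboot : BootWeakConv Pr (fun L ω ι => bootProcess (bl := bl) (bu := bu) Mhat What
      (sample B L ω) ι) Γ)
    (hvar : UniformlyConsistent Pr s2hat fun p => κ p p) (hε : 0 < ε)
    (href : 0 < κ (refIdx hb) (refIdx hb)) (hQ : ∀ p, 0 < Q p) (hs : Summable Q)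
    {a b : ℝ} (ha : 0 ≤ a) (hab : a < b) :
    WithHighProb Pr fun L ω => ∀ ι,
      bootStat Mhat What kap beta Q (sigmaEps hb ε (s2hat L ω)) (sample B L ω) ι
        ≤ ENNReal.ofReal (a ^ 2) →
      cvmRoot (bindingWeight (limitWeight hb κ Q ε) ν) (fun _ => 0)
        (toLinf (bootProcess Mhat What (sample B L ω) ι)) ≤ b := by
  obtain ⟨θ, hθ, hθ2, h1, h2⟩ := exists_slack ha hab
  have hw : ∀ p, 0 ≤ limitWeight hb κ Q ε p := fun p => (limitWeight_pos hε href hQ p).le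
  refine ((hvar.withHighProb_ratio (hb := hb) hε href hθ).and
    (withHighProb_gms_eq_zero hN hGMS hlim hvar hε href)).mono
    (Eventually.of_forall fun L ω hω ι hle => ?_)
  have hmpos : ∀ p, 0 < max (s2hat L ω p) (ε * s2hat L ω (refIdx hb)) := fun p =>
    lt_of_lt_of_le (mul_pos (by linarith) (limitVar_pos hε href p)) (hω.1 p).1
  rw [bootStat_eq (s := sigmaEps hb ε (s2hat L ω)) fun p => Real.sqrt_pos.2 (hmpos p)] at hle
  refine cvmRoot_le_of_cvm_div_sqrt_le (limitVar_pos hε href) (bindingWeight_nonneg hw)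
    (summable_bindingWeight hw (summable_limitWeight hε href hQ hs)) hθ hmpos
    (fun p => (hω.1 p).2) (fun p => (hQ p).le) (fun p => ?_) (ha.trans hab.le) hle h2
  rw [coe_toLinf (hboot.bounded L ω ι)]
  unfold bindingWeight
  split_ifs with h
  · exact Or.inl rfl
  · refine Or.inr ⟨rfl, ?_⟩
    rw [hω.2 p (not_lt.1 h)]
    simp

/-- The test statistic diverges as soon as one moment is positive. -/
lemma withHighProb_testStat_gt (hN : 1 ≤ N)
    (hlim : WeakConv Pr (fun L ω => estProcess Mhat What ν (sample B L ω)) Γ)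
    (hvar : UniformlyConsistent Pr s2hat fun p => κ p p) (hε : 0 < ε)
    (href : 0 < κ (refIdx hb) (refIdx hb)) (hQ : ∀ p, 0 < Q p)
    {p : Idx bl bu} (hp : 0 < ν p) {R : ℝ} (hR : 0 ≤ R) :
    WithHighProb Pr fun L ω => ENNReal.ofReal R
      < testStat Mhat What Q (sigmaEps hb ε (s2hat L ω)) (sample B L ω) := by
  have hv := limitVar_pos hε href p
  -- The numerator size at which this single term already reaches `R + 1`, allowing for a variance
  -- overestimated by half. The noise takes at most half of the drift.
  set A := √((R + 1) * ((1 + 1 / 2) * limitVar hb κ ε p) / Q p)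
  have hQp := hQ p
  have hhalf : Tendsto (fun L => sqrtS N L * (ν p / 2)) atTop atTop :=
    (tendsto_sqrtS hN).atTop_mul_const (by positivity)
  refine ((hvar.withHighProb_ratio (hb := hb) hε href (show (0 : ℝ) < 1 / 2 by norm_num)).and
    (hlim.withHighProb_norm_le hhalf)).mono ?_
  filter_upwards [hhalf.eventually_ge_atTop A] with L hL ω hω
  have h1 := (abs_le.1 (abs_coord_le (toLinf (estProcess Mhat What ν (sample B L ω))) p)).1
  rw [coe_toLinf (hlim.bounded L ω)] at h1
  have h2 := hω.2
  set m := max (s2hat L ω p) (ε * s2hat L ω (refIdx hb))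
  have hm : 0 < m := lt_of_lt_of_le (mul_pos (by norm_num) hv) (hω.1 p).1
  have hx : A ≤ estProcess Mhat What ν (sample B L ω) p + sqrtS N L * ν p := by linarith
  set x := estProcess Mhat What ν (sample B L ω) p + sqrtS N L * ν p
  have hA : 0 ≤ A := Real.sqrt_nonneg _
  have hx0 : 0 ≤ x / √m := div_nonneg (hA.trans hx) (Real.sqrt_nonneg _)
  have hterm : R + 1 ≤ (max (x / √m) 0) ^ 2 * Q p := by
    rw [max_eq_left hx0, div_pow, Real.sq_sqrt hm.le]
    have hA2 : A ^ 2 = (R + 1) * ((1 + 1 / 2) * limitVar hb κ ε p) / Q p :=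
      Real.sq_sqrt (by positivity)
    have h3 : A ^ 2 ≤ x ^ 2 := pow_le_pow_left₀ hA hx 2
    rw [hA2, div_le_iff₀ hQp] at h3
    rw [div_mul_eq_mul_div, le_div_iff₀ hm]
    exact (mul_le_mul_of_nonneg_left (hω.1 p).2 (by linarith)).trans h3
  calc ENNReal.ofReal R < ENNReal.ofReal (R + 1) :=
        (ENNReal.ofReal_lt_ofReal_iff (by linarith)).2 (by linarith)
    _ ≤ ENNReal.ofReal ((max (x / √m) 0) ^ 2 * Q p) := ENNReal.ofReal_le_ofReal hterm
    _ ≤ testStat Mhat What Q (sigmaEps hb ε (s2hat L ω)) (sample B L ω) := by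
        unfold testStat
        rw [show studentized Mhat What (sigmaEps hb ε (s2hat L ω)) (sample B L ω) = _ from
          funext fun p => studentized_eq (ν := ν) _ _ p]
        exact ENNReal.le_tsum p

end Sandwich

end MonotoneTest

/-! ### Size and consistency of the test. -/

theorem theorem2
    {Ω : Type*} [MeasurableSpace Ω] (Pr : Measure Ω) [IsProbabilityMeasure Pr]
    (N : ℕ) (hN : 1 ≤ N) (bl bu : ℝ) (hb : bl < bu)
    -- the observed actions
    (G : Measure ℝ) (B : ℕ → Fin N → Ω → ℝ)
    (hB : MonotoneTest.IsActionSample Pr N bl bu G B)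
    -- allocation and payment functions, and their reduced forms
    (D C : ℝ → (Fin (N - 1) → ℝ) → ℝ)
    (hD : ∀ b ∈ Ioo bl bu, Integrable (D b) (Measure.pi fun _ : Fin (N - 1) => G))
    (hC : ∀ b ∈ Ioo bl bu, Integrable (C b) (Measure.pi fun _ : Fin (N - 1) => G))
    (P T : ℝ → ℝ) (hP : P = MonotoneTest.interim N G D) (hT : T = MonotoneTest.interim N G C)
    (hPT : MonotoneTest.RegularReducedForm bl bu P T)
    (h : ℝ → ℝ) (hh : MonotoneTest.IsWeight bl bu P h)
    -- estimators of the moments and of their asymptotic variances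
    (Mhat What : MonotoneTest.Estimator N) (hMhat : Mhat.IsMeasurable) (hWhat : What.IsMeasurable)
    (s2hat : ℕ → Ω → MonotoneTest.Idx bl bu → ℝ)
    (hs2hat : ∀ L p, Measurable fun ω => s2hat L ω p)
    -- Gaussian limit
    (κ : MonotoneTest.Idx bl bu → MonotoneTest.Idx bl bu → ℝ) (hκ : ∃ p p', κ p p' ≠ 0)
    (Γ : Measure (MonotoneTest.Linf (MonotoneTest.Idx bl bu)))
    (hΓ : MonotoneTest.IsGaussianLaw Γ κ)
    (hlim : MonotoneTest.WeakConv Pr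
      (fun L ω => MonotoneTest.estProcess Mhat What (MonotoneTest.nu bl bu P T h)
        (MonotoneTest.sample B L ω)) Γ)
    -- uniformly consistent variance estimator, nondegenerate reference moment
    (hvar : MonotoneTest.UniformlyConsistent Pr s2hat fun p => κ p p)
    (href : 0 < κ (MonotoneTest.refIdx hb) (MonotoneTest.refIdx hb))
    -- validity of the bootstrap
    (hboot : MonotoneTest.BootWeakConv Pr
      (fun L ω ι => MonotoneTest.bootProcess Mhat What (MonotoneTest.sample B L ω) ι) Γ)
    -- tuning parameters
    (kap beta : ℕ → ℝ) (hGMS : MonotoneTest.GMSRates kap beta)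
    (Q : MonotoneTest.Idx bl bu → ℝ) (hQpos : ∀ p, 0 < Q p) (hQsum : Summable Q)
    (ε : ℝ) (hε : 0 < ε) (α : ℝ) (hα : α < 1 / 2) (η : ℝ) (hη : 0 < η) (hηα : η < α) :
    (MonotoneOn (MonotoneTest.xi P T) (Ioo bl bu) →
      ∃ r ≤ α, Tendsto
        (MonotoneTest.rejectProb Pr hb B Mhat What s2hat Q kap beta ε α η) atTop (𝓝 r)) ∧
    (¬ MonotoneOn (MonotoneTest.xi P T) (Ioo bl bu) →
      Tendsto
        (MonotoneTest.rejectProb Pr hb B Mhat What s2hat Q kap beta ε α η) atTop (𝓝 1)) := by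
  have hΓp := hΓ.isProbabilityMeasure
  set ν := MonotoneTest.nu bl bu P T h
  -- A summable family of positive weights has a countable index set.
  have : Countable (MonotoneTest.Idx bl bu) := by
    have hc := hQsum.countable_support
    rwa [show Function.support Q = univ from
      eq_univ_of_forall fun p => Function.mem_support.2 (hQpos p).ne', countable_univ_iff] at hc
  obtain ⟨f, hf⟩ := exists_injective_nat (MonotoneTest.Idx bl bu)
  set w := MonotoneTest.limitWeight hb κ Q ε
  have hw0 : ∀ p, 0 < w p := MonotoneTest.limitWeight_pos hε href hQpos
  have hw : ∀ p, 0 ≤ w p := fun p => (hw0 p).le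
  have hws : Summable w := MonotoneTest.summable_limitWeight hε href hQpos hQsum
  set Un := fun n => MonotoneTest.cvmRoot w (MonotoneTest.slackShift ν f n)
  set w₀ := MonotoneTest.bindingWeight w ν
  have hw₀ : ∀ p, 0 ≤ w₀ p := MonotoneTest.bindingWeight_nonneg hw
  have hws₀ : Summable w₀ := MonotoneTest.summable_bindingWeight hw hws
  set U := MonotoneTest.cvmRoot w₀ fun _ => 0
  have hU := MonotoneTest.lipschitzWith_cvmRoot hw₀ hws₀ (c := fun _ => 0) fun _ => le_rfl
  have hUn := fun n => MonotoneTest.lipschitzWith_cvmRoot hw hws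
    (MonotoneTest.slackShift_nonpos (ν := ν) (f := f) n)
  have hanti : ∀ z, Antitone fun n => Un n z :=
    MonotoneTest.antitone_cvmRoot_slackShift hw hws
  have hpt : ∀ z, Tendsto (fun n => Un n z) atTop (𝓝 (U z)) :=
    MonotoneTest.tendsto_cvmRoot_slackShift hw hws
  set X : ℕ → Ω → ℝ≥0∞ := fun L ω => MonotoneTest.testStat Mhat What Q
    (MonotoneTest.sigmaEps hb ε (s2hat L ω)) (MonotoneTest.sample B L ω)
  set F : (L : ℕ) → Ω → (Fin L → Fin L) → ℝ≥0∞ := fun L ω => MonotoneTest.bootStat Mhat What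
    kap beta Q (MonotoneTest.sigmaEps hb ε (s2hat L ω)) (MonotoneTest.sample B L ω)
  set β := 1 - α + η
  have hrej : MonotoneTest.rejectProb Pr hb B Mhat What s2hat Q kap beta ε α η
      = fun L => Pr.real {ω | MonotoneTest.upperQuantile (F L ω) β η < (X L ω : EReal)} := rfl
  have hupB : ∀ (n : ℕ) (a b : ℝ), 0 ≤ a → a < b → MonotoneTest.WithHighProb Pr fun L ω => ∀ ι,
      Un n (MonotoneTest.toLinf (MonotoneTest.bootProcess Mhat What
        (MonotoneTest.sample B L ω) ι)) ≤ a → F L ω ι ≤ ENNReal.ofReal (b ^ 2) :=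
    fun n a b ha hab =>
      MonotoneTest.bootStat_le hN hGMS hlim hboot hvar hε href hQpos hQsum hf n ha hab
  rw [hrej]
  constructor
  · intro hmono
    have hν : ∀ p, ν p ≤ 0 := MonotoneTest.nu_nonpos_of_monotoneOn hb hPT hh hmono
    have hupT : ∀ (n : ℕ) (a b : ℝ), 0 ≤ a → a < b → MonotoneTest.WithHighProb Pr fun L ω =>
        Un n (MonotoneTest.toLinf (MonotoneTest.estProcess Mhat What ν
          (MonotoneTest.sample B L ω))) ≤ a → X L ω ≤ ENNReal.ofReal (b ^ 2) :=
      fun n a b ha hab =>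
        MonotoneTest.testStat_le hN hν hlim hvar hε href hQpos hQsum hf n ha hab
    have hlowT : ∀ a b : ℝ, 0 ≤ a → a < b → MonotoneTest.WithHighProb Pr fun L ω =>
        X L ω ≤ ENNReal.ofReal (a ^ 2) → U (MonotoneTest.toLinf
          (MonotoneTest.estProcess Mhat What ν (MonotoneTest.sample B L ω))) ≤ b :=
      fun a b ha hab => MonotoneTest.le_testStat hlim hvar hε href hQpos hQsum ha hab
    have hlowB : ∀ a b : ℝ, 0 ≤ a → a < b → MonotoneTest.WithHighProb Pr fun L ω => ∀ ι,
        F L ω ι ≤ ENNReal.ofReal (a ^ 2) → U (MonotoneTest.toLinf (MonotoneTest.bootProcess Mhat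
          What (MonotoneTest.sample B L ω) ι)) ≤ b :=
      fun a b ha hab =>
        MonotoneTest.le_bootStat hN hGMS hlim hboot hvar hε href hQpos hQsum ha hab
    have hUm := hU.continuous.measurable
    by_cases hdeg : ∃ p, 0 < w₀ p ∧ 0 < κ p p
    · obtain ⟨p₀, hp₀, hκ₀⟩ := hdeg
      obtain ⟨q, hq, hql, hqu⟩ := hΓ.exists_quantile hw₀ hws₀ hp₀ hκ₀ (β := β)
        (by simp only [β]; linarith) (by simp only [β]; linarith)
      -- The limit of the critical value on the root scale. Because `η > 0` it lies strictly above
      -- the quantile `q`.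
      set t := √(q ^ 2 + η)
      have ht2 : t ^ 2 = q ^ 2 + η := Real.sq_sqrt (by positivity)
      have hqt : q < t := Real.lt_sqrt_of_sq_lt (by linarith)
      have ht : 0 < t := hq.trans hqt
      have hnull : Γ {z | U z = t} = 0 := hΓ.cvmRoot_level_null hw₀ hws₀ ht
      have hc1 : ∀ c, 0 ≤ c → c < t → MonotoneTest.WithHighProb Pr fun L ω =>
          ((c ^ 2 : ℝ) : EReal) ≤ MonotoneTest.upperQuantile (F L ω) β η := by
        intro c hc hct
        have hc2 : c ^ 2 < q ^ 2 + η := ht2 ▸ pow_lt_pow_left₀ hct hc two_ne_zero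
        -- If `c ^ 2 < η` the root is `0`, and the bound `η` alone suffices.
        set u := √(c ^ 2 - η)
        have huq : u < q := (Real.sqrt_lt' hq).2 (by linarith)
        obtain ⟨v, huv, hvq⟩ := exists_between huq
        refine (MonotoneTest.withHighProb_le_upperQuantile (η := η) hboot hU hlowB
          (Real.sqrt_nonneg _) huv (hql v ((Real.sqrt_nonneg _).trans huv.le) hvq)).mono
          (Eventually.of_forall fun L ω hω => le_trans (EReal.coe_le_coe_iff.2 ?_) hω)
        rcases le_total 0 (c ^ 2 - η) with h0 | h0
        · rw [Real.sq_sqrt h0]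
          linarith
        · nlinarith [sq_nonneg u]
      have hc2 : ∀ c, t < c → MonotoneTest.WithHighProb Pr fun L ω =>
          MonotoneTest.upperQuantile (F L ω) β η ≤ ((c ^ 2 : ℝ) : EReal) := by
        intro c htc
        have hc2 : q ^ 2 + η < c ^ 2 := ht2 ▸ pow_lt_pow_left₀ htc ht.le two_ne_zero
        set u := √(c ^ 2 - η)
        have hu2 : u ^ 2 = c ^ 2 - η := Real.sq_sqrt (by nlinarith)
        have hqu' : q < u := Real.lt_sqrt_of_sq_lt (by linarith)
        obtain ⟨v, hqv, hvu⟩ := exists_between hqu'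
        obtain ⟨v', hqv', hvv'⟩ := exists_between hqv
        -- The upper bound is available only for `Un n`; a large `n` keeps its distribution function
        -- above `β` slightly to the right of `v'`.
        obtain ⟨n, hn⟩ := MonotoneTest.exists_cdf_gt hanti hpt hvv' (hqu v' hqv')
        have := MonotoneTest.withHighProb_upperQuantile_le (η := η) hboot (hUn n) (hupB n)
          (hq.trans hqv).le hvu hn
        rwa [hu2, sub_add_cancel] at this
      refine ⟨Γ.real {z | t < U z}, ?_, tendsto_order.2 ⟨fun x hx => ?_, fun x hx => ?_⟩⟩
      · rw [MonotoneTest.measureReal_lt_eq hUm]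
        have := hqu t hqt
        simp only [β] at this
        linarith
      · filter_upwards [MonotoneTest.eventually_reject_ge hlim hU.continuous hlowT ht.le hc2
          (half_pos (sub_pos.2 hx))] with L hL
        linarith
      · filter_upwards [MonotoneTest.eventually_reject_le hlim hUm (fun n => (hUn n).continuous)
          hanti hpt hupT ht hnull hc1 (half_pos (sub_pos.2 hx))] with L hL
        linarith
    -- Degenerate case: the limit of the statistic is zero, and the critical value is at least `η`.
    · push Not at hdeg
      have hU0 : ∀ᵐ z ∂Γ, U z = 0 := hΓ.ae_cvmRoot_eq_zero fun p => by
        rcases (hw₀ p).eq_or_lt with h0 | h0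
        · exact Or.inl h0.symm
        · exact Or.inr (le_antisymm (hdeg p h0) (hΓ.var_nonneg p))
      have ht : 0 < √η := Real.sqrt_pos.2 hη
      have hnull : Γ {z | U z = √η} = 0 := by
        have : ∀ᵐ z ∂Γ, ¬ U z = √η := by
          filter_upwards [hU0] with z hz
          rw [hz]
          exact ht.ne
        rw [ae_iff] at this
        simpa only [not_not] using this
      have htail : Γ.real {z | √η < U z} = 0 := by
        have : ∀ᵐ z ∂Γ, ¬ √η < U z := by
          filter_upwards [hU0] with z hz
          rw [hz]
          exact not_lt.2 ht.le
        rw [ae_iff] at this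
        simp only [not_not] at this
        rw [measureReal_def, this, ENNReal.toReal_zero]
      have hc1 : ∀ c, 0 ≤ c → c < √η → MonotoneTest.WithHighProb Pr fun L ω =>
          ((c ^ 2 : ℝ) : EReal) ≤ MonotoneTest.upperQuantile (F L ω) β η := by
        intro c hc hct
        have hc2 : c ^ 2 ≤ η := Real.sq_sqrt hη.le ▸ pow_le_pow_left₀ hc hct.le 2
        have : ∀ L ω, ((c ^ 2 : ℝ) : EReal) ≤ MonotoneTest.upperQuantile (F L ω) β η :=
          fun L ω => (EReal.coe_le_coe_iff.2 hc2).trans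
            (MonotoneTest.eta_le_upperQuantile (by simp only [β]; linarith))
        have hnever : ∀ L, {ω | ¬ ((c ^ 2 : ℝ) : EReal)
            ≤ MonotoneTest.upperQuantile (F L ω) β η} = ∅ := fun L =>
          eq_empty_of_forall_notMem fun ω hω => hω (this L ω)
        simp only [MonotoneTest.WithHighProb, hnever, measure_empty]
        exact tendsto_const_nhds
      refine ⟨0, by linarith, tendsto_order.2 ⟨fun x hx => Eventually.of_forall fun L =>
        hx.trans_le measureReal_nonneg, fun x hx => ?_⟩⟩
      filter_upwards [MonotoneTest.eventually_reject_le hlim hUm (fun n => (hUn n).continuous)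
        hanti hpt hupT ht hnull hc1 (half_pos hx)] with L hL
      linarith
  · intro hmono
    obtain ⟨p, hp⟩ := MonotoneTest.exists_nu_pos hb hPT hh hmono
    have hβ : β < 1 := by simp only [β]; linarith
    -- With `Un 0` no moment is shifted. Since `β < 1`, its law exceeds level `β` at a finite point,
    -- which bounds the critical value.
    obtain ⟨n, hn⟩ := ((MonotoneTest.tendsto_measureReal_gt_atTop (μ := Γ)
      (hUn 0).continuous.measurable).eventually (gt_mem_nhds (sub_pos.2 hβ))).exists
    rw [MonotoneTest.measureReal_lt_eq (hUn 0).continuous.measurable] at hn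
    have hcrit := MonotoneTest.withHighProb_upperQuantile_le (η := η) (β := β) hboot (hUn 0)
      (hupB 0) (Nat.cast_nonneg n) (show (n : ℝ) < n + 1 by linarith) (by linarith)
    exact MonotoneTest.tendsto_reject_one (by positivity) hcrit
      (MonotoneTest.withHighProb_testStat_gt hN hlim hvar hε href hQpos hp (by positivity))
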